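/- **Theorem 4.4.** All graphs are countable, connected, locally finite and simple. Let $\mathcal G_\bullet$, $\mathcal G_{\bullet\bullet}$ and $\vec{\mathcal G}$ be the spaces of isomorphism classes of graphs with, respectively, one root, two ordered roots, and a sequence of vertices, each with the Borel $\sigma$-algebra of the local distance. Let $(G,\rho)$ be a random rooted graph with law $\mathbf P$ on $\mathcal G_\bullet$; conditionally on $(G,\rho)$ let $(X_n)_{n\ge 0}$ be the simple random walk on $G$ started at $\rho$ (on the one-vertex graph the walk stays put), and let $\mathbb P$, with expectation $\mathbb E$, be the law of $(G,(X_n)_{n\ge0})$ on $\vec{\mathcal G}$. Suppose that - $(G,\rho)$ is stationary: $(G,X_n)=(G,\rho)$ in distribution for all $n\ge 1$; - $(G,\rho)$ is ergodic: every event invariant under the shift $(G,(x_n)_{n\ge0})\mapsto(G,(x_{n+1})_{n\ge0})$ has $\mathbb P$-probability $0$ or $1$; - for some real $M>0$, almost surely every vertex of $G$ has degree at most $M$; - $(G,\rho)$ is not reversible: $(G,X_0,X_1)$ and $(G,X_1,X_0)$ do not have the same law. Let $\mu_\rightarrow$ and $\mu_\leftarrow$ be the laws on $\mathcal G_{\bullet\bullet}$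 of $(G,X_0,X_1)$ and $(G,X_1,X_0)$. Then $\mu_\rightarrow$ and $\mu_\leftarrow$ are mutually absolutely continuous and, with the Radon–Nikodym cocycle $\Delta=\frac{d\mu_\leftarrow}{d\mu_\rightarrow}$, the variable $\log\Delta(G,X_0,X_1)$ is $\mathbb P$-integrable. Moreover there is a constant $s$, the speed of the walk, such that $$\frac{d^G_{\mathrm{gr}}(X_0,X_n)}{n}\xrightarrow[n\to\infty]{} s\qquad \mathbb P\text{-almost surely and in } L^1(\mathbb P),$$ where $d^G_{\mathrm{gr}}$ is the graph distance, and $$s\;\ge\;\frac{\bigl|\mathbb E[\log\Delta(G,X_0,X_1)]\bigr|}{\log M}\;>\;0 .$$ In particular $s>0$. -/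

import Mathlib

open MeasureTheory ProbabilityTheory Filter Topology

namespace StationaryGraph

/-- A countable, connected, locally finite, simple graph. The vertex set is a set of natural
numbers, so every countable graph is isomorphic to one of these. -/
structure LFGraph where
  V : Set ℕ
  graph : SimpleGraph V
  connected : graph.Connected
  locallyFinite : ∀ v, (graph.neighborSet v).Finite

namespace LFGraph

variable (G : LFGraph)

/-- The finite set of neighbours of a vertex. -/
noncomputable def nbrs (v : G.V) : Finset G.V := (G.locallyFinite v).toFinset

/-- The degree of a vertex. -/
noncomputable def deg (v : G.V) : ℕ := (G.nbrs v).card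

/-- The vertices at graph distance at most `r` from `x`. -/
def ball (x : G.V) (r : ℕ) : Set G.V := {v | G.graph.dist x v ≤ r}

open scoped Classical in
/-- One step of simple random walk: uniform on the neighbours of `v`. A vertex without neighbours
occurs only in the one-vertex graph; there, by convention, the walk stays put. -/
noncomputable def step (v : G.V) : PMF G.V :=
  if h : (G.nbrs v).Nonempty then PMF.uniformOfFinset (G.nbrs v) h else PMF.pure v

/-- The transition kernel of simple random walk (the vertex set carries its discrete σ-algebra). -/
noncomputable def stepKernel : Kernel G.V G.V where
  toFun v := (G.step v).toMeasure
  measurable' := measurable_of_countable _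

instance : IsMarkovKernel G.stepKernel :=
  ⟨fun v => (inferInstance : IsProbabilityMeasure (G.step v).toMeasure)⟩

/-- The transition at time `n`, as a kernel from the history up to time `n`: it looks only at the
present position. -/
noncomputable def historyKernel (n : ℕ) : Kernel (Finset.Iic n → G.V) G.V :=
  G.stepKernel.comap (fun h => h ⟨n, Finset.mem_Iic.2 le_rfl⟩) (measurable_pi_apply _)

instance (n : ℕ) : IsMarkovKernel (G.historyKernel n) := by
  unfold historyKernel; infer_instance

/-- The law of the simple random walk on `G` started at `x`, a measure on vertex sequences. -/
noncomputable def srw (x : G.V) : Measure (ℕ → G.V) :=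
  Kernel.trajMeasure (X := fun _ => G.V) (Measure.dirac x) (fun n => G.historyKernel n)

end LFGraph

/-- A graph with a family of distinguished vertices indexed by `ι`. -/
structure Marked (ι : Type) where
  G : LFGraph
  mark : ι → G.V

/-- Isomorphism of graphs with distinguished vertices: the marks have to be respected. -/
def isoSetoid (ι : Type) : Setoid (Marked ι) where
  r A B := ∃ φ : A.G.graph ≃g B.G.graph, ∀ i, φ (A.mark i) = B.mark i
  iseqv :=
    { refl := fun _ => ⟨SimpleGraph.Iso.refl, fun _ => rfl⟩
      symm := by
        rintro A B ⟨φ, h⟩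
        exact ⟨φ.symm, fun i => by rw [← h i]; exact φ.symm_apply_apply _⟩
      trans := by
        rintro A B C ⟨φ, h⟩ ⟨ψ, k⟩
        exact ⟨φ.trans ψ, fun i => by
          rw [← k i, ← h i]; rfl⟩ }

/-- Isomorphism classes of graphs with distinguished vertices indexed by `ι`. -/
def MarkedClass (ι : Type) : Type := Quotient (isoSetoid ι)

/-- The isomorphism class of a marked graph. -/
def Marked.cls {ι : Type} (A : Marked ι) : MarkedClass ι := Quotient.mk (isoSetoid ι) A

/-- A canonical representative of an isomorphism class, chosen once and for all. -/
noncomputable def MarkedClass.rep {ι : Type} (q : MarkedClass ι) : Marked ι := Quotient.out q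

/-- `A` and `B` agree up to radius `r`: some isomorphism between the balls of radius `r` around the
marks `o` respects each mark `i` with `idx i ≤ r` (such a mark lies in one ball exactly when it lies
in the other, and then the isomorphism maps one to the other). -/
def Agree {ι : Type} (o : ι) (idx : ι → ℕ) (r : ℕ) (A B : Marked ι) : Prop :=
  ∃ φ : A.G.graph.induce (A.G.ball (A.mark o) r) ≃g B.G.graph.induce (B.G.ball (B.mark o) r),
    ∀ i, idx i ≤ r → ∀ v, v.1 = A.mark i ↔ (φ v).1 = B.mark i

/-- The local distance `inf {1 / (r + 1) : the graphs agree up to radius r}`. -/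
noncomputable def locDist {ι : Type} (o : ι) (idx : ι → ℕ) (p q : MarkedClass ι) : ℝ :=
  sInf {t : ℝ | ∃ r : ℕ, Agree o idx r p.rep q.rep ∧ t = 1 / ((r : ℝ) + 1)}

/-- The topology of a distance function: a set is open when it contains, with each of its points,
a ball of positive radius around it. -/
@[reducible] def distTopology {α : Type} (d : α → α → ℝ) : TopologicalSpace α where
  IsOpen U := ∀ x ∈ U, ∃ ε > 0, ∀ y, d x y < ε → y ∈ U
  isOpen_univ := fun _ _ => ⟨1, one_pos, fun _ _ => trivial⟩
  isOpen_inter := by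
    rintro s t hs ht x ⟨hxs, hxt⟩
    obtain ⟨ε, hε, h⟩ := hs x hxs
    obtain ⟨δ, hδ, k⟩ := ht x hxt
    exact ⟨min ε δ, lt_min hε hδ, fun y hy =>
      ⟨h y (hy.trans_le (min_le_left _ _)), k y (hy.trans_le (min_le_right _ _))⟩⟩
  isOpen_sUnion := by
    rintro S hS x ⟨s, hs, hx⟩
    obtain ⟨ε, hε, h⟩ := hS s hs x hx
    exact ⟨ε, hε, fun y hy => ⟨s, hs, h y hy⟩⟩

/-- The space of rooted graphs `(G, ρ)`. -/
abbrev Rooted : Type := MarkedClass Unit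

/-- The space of bi-rooted graphs `(G, x, y)`. -/
abbrev BiRooted : Type := MarkedClass (Fin 2)

/-- The space of graphs with a vertex sequence `(G, (xₙ))`. The laws considered below charge only
walks of the simple random walk, hence nearest-neighbour paths. -/
abbrev PathSpace : Type := MarkedClass ℕ

noncomputable instance : TopologicalSpace Rooted := distTopology (locDist () (fun _ => 0))

noncomputable instance : TopologicalSpace BiRooted := distTopology (locDist 0 Fin.val)

noncomputable instance : TopologicalSpace PathSpace := distTopology (locDist 0 id)

noncomputable instance : MeasurableSpace Rooted := borel _

noncomputable instance : MeasurableSpace BiRooted := borel _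

noncomputable instance : MeasurableSpace PathSpace := borel _

/-- The law of `(G, (Xₙ))`, where `(Xₙ)` is the simple random walk on the fixed rooted graph
`(G, ρ)` started at `ρ`. -/
noncomputable def walkLawFrom (g : Rooted) : Measure PathSpace :=
  (g.rep.G.srw (g.rep.mark ())).map (fun x => (Marked.mk g.rep.G x).cls)

/-- The law of `(G, (Xₙ))` when `(G, ρ)` has law `P` and, conditionally on `(G, ρ)`, `(Xₙ)` is the
simple random walk on `G` started at `ρ`. -/
noncomputable def walkLaw (P : Measure Rooted) : Measure PathSpace := P.bind walkLawFrom

/-- `(G, (xₙ)) ↦ (G, xₙ)`. -/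
noncomputable def rootAt (n : ℕ) (q : PathSpace) : Rooted :=
  (Marked.mk q.rep.G (fun _ => q.rep.mark n)).cls

/-- `(G, (xₙ)) ↦ (G, xₘ, xₙ)`. -/
noncomputable def biRootAt (m n : ℕ) (q : PathSpace) : BiRooted :=
  (Marked.mk q.rep.G ![q.rep.mark m, q.rep.mark n]).cls

/-- The shift `(G, (xₙ)) ↦ (G, (xₙ₊₁))`. -/
noncomputable def shift (q : PathSpace) : PathSpace :=
  (Marked.mk q.rep.G (fun n => q.rep.mark (n + 1))).cls

/-- The graph distance `d(x₀, xₙ)`. -/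
noncomputable def distAt (n : ℕ) (q : PathSpace) : ℕ :=
  q.rep.G.graph.dist (q.rep.mark 0) (q.rep.mark n)

/-- `(G, ρ)` of law `P` is stationary: `(G, Xₙ) = (G, ρ)` in distribution for all `n ≥ 1`. -/
def IsStationaryGraph (P : Measure Rooted) : Prop :=
  ∀ n : ℕ, 1 ≤ n → (walkLaw P).map (rootAt n) = P

/-- The law of `(G, X₀, X₁)`. -/
noncomputable def forwardLaw (P : Measure Rooted) : Measure BiRooted :=
  (walkLaw P).map (biRootAt 0 1)

/-- The law of `(G, X₁, X₀)`. -/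
noncomputable def backwardLaw (P : Measure Rooted) : Measure BiRooted :=
  (walkLaw P).map (biRootAt 1 0)

/-- `(G, ρ)` of law `P` is reversible: `(G, X₀, X₁) = (G, X₁, X₀)` in distribution. -/
def IsReversibleGraph (P : Measure Rooted) : Prop := forwardLaw P = backwardLaw P

/-- `(G, ρ)` of law `P` is ergodic: every shift-invariant event has probability zero or one under
the law of `(G, (Xₙ))`. For stationary `P` that law is preserved by the shift. -/
def IsErgodicGraph (P : Measure Rooted) : Prop := PreErgodic shift (walkLaw P)

/-- Almost surely all degrees are at most `M`. -/
def DegreesBoundedBy (P : Measure Rooted) (M : ℝ) : Prop :=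
  ∀ᵐ g ∂P, ∀ v : g.rep.G.V, (g.rep.G.deg v : ℝ) ≤ M

/-- The Radon–Nikodym cocycle `Δ` on neighbouring pairs: the density of the law of `(G, X₁, X₀)`
with respect to the law of `(G, X₀, X₁)`. -/
noncomputable def cocycle (P : Measure Rooted) (b : BiRooted) : ℝ :=
  ((backwardLaw P).rnDeriv (forwardLaw P) b).toReal

/-- `log Δ(G, X₀, X₁)`, as a random variable on the path space. -/
noncomputable def logCocycle (P : Measure Rooted) (q : PathSpace) : ℝ :=
  Real.log (cocycle P (biRootAt 0 1 q))

end StationaryGraph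

open StationaryGraph

/-!
The proof rests on the cocycle property of `Δ` along closed paths and on the subadditive ergodic
theorem.

A stationary walk returns along its last edge with conditional probability at least `1 / M` (for
`M ≥ 1`; a smaller `M` leaves only the one-vertex graph, which is reversible), so each
of the laws of `(G, X₀, X₁)` and `(G, X₁, X₀)` is at most `M` times the other
(`backwardLaw_le_smul`, `forwardLaw_le_smul`). Hence they are equivalent and `|log Δ| ≤ log M`.

Stationarity and the Markov property show that the law of `(G, Xₙ, …, X₀)` has the density
`∏ Δ(G, Xᵢ, Xᵢ₊₁)` with respect to the law of `(G, X₀, …, Xₙ)` (`lintegral_reverse`). On the other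
hand, simple random walk conditioned to be back at time `n` is invariant under time reversal
(`LFGraph.lintegral_loop_rev`). So the product of `Δ` along almost every closed path of the walk is
one (`ae_densityProd_eq_one`). Every finite path in `G` from the root has positive probability;
close the path `X₀, …, Xₙ` by a geodesic from `Xₙ` to `X₀`. The product over the geodesic is between
`M ^ (-d)` and `M ^ d` with `d = d(X₀, Xₙ)`, so `|∑ log Δ(G, Xᵢ, Xᵢ₊₁)| ≤ d(X₀, Xₙ) log M`
(`ae_abs_sum_log_cocycle_le`). Taking expectations, `n |E log Δ| ≤ log M · E d(X₀, Xₙ)` for all `n`.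

The distance `d(X₀, Xₙ)` is subadditive and at most `n`, and the shift is measure preserving and
ergodic, so Kingman's theorem (`exists_tendsto_div_of_subadditive`) gives the speed, which is the
infimum of `E d(X₀, Xₙ) / n` and thus at least `|E log Δ| / log M`. Finally `E Δ = 1` and strict
convexity give `E log Δ < 0`, as `Δ = 1` almost surely would mean reversibility
(`integral_log_cocycle_neg`).

Measurability on the spaces of isomorphism classes is reduced to the basic sets of the local
distance: they form a π-system generating the Borel σ-algebra, because there are only countably many
balls of a given radius up to isomorphism (`borel_eq_generateFrom_basicSet`).
-/

/-! ### Kingman's subadditive ergodic theorem -/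

namespace StationaryGraph

section Subadditive

variable {Ω : Type*} {T : Ω → Ω} {a : ℕ → Ω → ℝ} {C : ℝ}

/-- The orbit segment of length `N` is cut greedily into blocks of length at most `L` on which the
average of `a` is at most `d`, single bad points where no such block starts, and a remainder of
length at most `L`. -/
theorem subadditive_le_of_block_cover
    (hsub : ∀ m n x, a (m + n) x ≤ a m x + a n (T^[m] x)) (d : ℝ) (L : ℕ) (N : ℕ) :
    ∀ x, (∀ i n, |a n (T^[i] x)| ≤ C * n) →
      a N x ≤ d * N + (C + |d|) * ∑ i ∈ Finset.range N,
        {y | ∃ n, 1 ≤ n ∧ n ≤ L ∧ a n y ≤ d * n}ᶜ.indicator (fun _ => (1 : ℝ)) (T^[i] x)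
        + (C + |d|) * L := by
  set S : Set Ω := {y | ∃ n, 1 ≤ n ∧ n ≤ L ∧ a n y ≤ d * n} with hS
  set f : Ω → ℝ := Sᶜ.indicator (fun _ => (1 : ℝ)) with hf
  have hf0 : ∀ y, 0 ≤ f y := fun y => Set.indicator_nonneg (fun _ _ => zero_le_one) y
  induction N using Nat.strong_induction_on with
  | _ N ih =>
    intro x hx
    have hC : 0 ≤ C := by
      have h := (abs_nonneg _).trans (hx 0 1)
      simpa using h
    have hE : 0 ≤ C + |d| := by positivity
    have hshift : ∀ m, ∀ i n, |a n (T^[i] (T^[m] x))| ≤ C * n := fun m i n => by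
      rw [← Function.iterate_add_apply]; exact hx _ _
    have hsum0 : ∀ n, 0 ≤ ∑ i ∈ Finset.range n, f (T^[i] x) :=
      fun n => Finset.sum_nonneg fun i _ => hf0 _
    rcases le_or_gt N L with hNL | hNL
    · have h1 : a N x ≤ C * N := (le_abs_self _).trans (by simpa using hx 0 N)
      have h2 : -|d| * N ≤ d * N := by
        gcongr
        exact neg_abs_le d
      have h3 : (C + |d|) * N ≤ (C + |d|) * L := by gcongr
      have h4 := mul_nonneg hE (hsum0 N)
      nlinarith
    · by_cases hxS : x ∈ S
      · obtain ⟨n, hn1, hnL, hn⟩ := hxS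
        have hk := ih (N - n) (by omega) (T^[n] x) (hshift n)
        have hs := hsub n (N - n) x
        obtain ⟨k, rfl⟩ : ∃ k, N = n + k := ⟨N - n, by omega⟩
        simp only [Nat.add_sub_cancel_left] at hk hs
        have hsplit : ∑ i ∈ Finset.range k, f (T^[i] (T^[n] x))
            ≤ ∑ i ∈ Finset.range (n + k), f (T^[i] x) := by
          rw [Finset.sum_range_add]
          have : ∀ i, f (T^[i] (T^[n] x)) = f (T^[n + i] x) := fun i => by
            rw [← Function.iterate_add_apply, add_comm]
          simp only [this]
          linarith [hsum0 n]
        have := mul_le_mul_of_nonneg_left hsplit hE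
        push_cast
        linarith
      · obtain ⟨k, rfl⟩ : ∃ k, N = 1 + k := ⟨N - 1, by omega⟩
        have hk := ih k (by omega) (T^[1] x) (hshift 1)
        have hs := hsub 1 k x
        have h1 : a 1 x ≤ C := (le_abs_self _).trans (by simpa using hx 0 1)
        have hsplit : 1 + ∑ i ∈ Finset.range k, f (T^[i] (T^[1] x))
            = ∑ i ∈ Finset.range (1 + k), f (T^[i] x) := by
          rw [Finset.sum_range_add]
          have : ∀ i, f (T^[i] (T^[1] x)) = f (T^[1 + i] x) := fun i => by
            rw [← Function.iterate_add_apply, add_comm]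
          simp only [this]
          simp [hf, hxS]
        rw [← hsplit, mul_add]
        have := neg_abs_le d
        push_cast
        linarith

variable [MeasurableSpace Ω] {μ : Measure Ω}

theorem ae_forall_iterate {p : Ω → Prop} (hT : MeasurePreserving T μ μ) (h : ∀ᵐ x ∂μ, p x) :
    ∀ᵐ x ∂μ, ∀ i, p (T^[i] x) :=
  ae_all_iff.2 fun i => (hT.iterate i).quasiMeasurePreserving.ae h

theorem integral_iterate_eq {f : Ω → ℝ} (hT : MeasurePreserving T μ μ) (hf : Measurable f) (i : ℕ) :
    ∫ x, f (T^[i] x) ∂μ = ∫ x, f x ∂μ := by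
  have h := (hT.iterate i).map_eq
  conv_rhs => rw [← h]
  rw [integral_map (hT.iterate i).measurable.aemeasurable hf.aestronglyMeasurable]

variable [IsProbabilityMeasure μ]

theorem integrable_of_linear_bound (hmeas : ∀ n, Measurable (a n))
    (hbd : ∀ᵐ x ∂μ, ∀ n, |a n x| ≤ C * n) (n : ℕ) : Integrable (a n) μ :=
  Integrable.of_bound (hmeas n).aestronglyMeasurable (C * n) (hbd.mono fun _ hx => hx n)

/-- If almost every point starts a block of average at most `d`, then the means of the process are
asymptotically at most `d`. -/
theorem le_of_ae_exists_block (hT : MeasurePreserving T μ μ) (hmeas : ∀ n, Measurable (a n))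
    (hsub : ∀ m n x, a (m + n) x ≤ a m x + a n (T^[m] x))
    (hbd : ∀ᵐ x ∂μ, ∀ n, |a n x| ≤ C * n) {s d : ℝ} (hs : ∀ n : ℕ, s * n ≤ ∫ x, a n x ∂μ)
    (hd : ∀ᵐ x ∂μ, ∃ n, 1 ≤ n ∧ a n x ≤ d * n) : s ≤ d := by
  set S : ℕ → Set Ω := fun L => {y | ∃ n, 1 ≤ n ∧ n ≤ L ∧ a n y ≤ d * n} with hS
  have hSm : ∀ L, MeasurableSet (S L) := fun L => by
    have : S L = ⋃ n, ⋃ (_ : 1 ≤ n ∧ n ≤ L), {y | a n y ≤ d * n} := by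
      ext y; simp [hS, and_assoc]
    rw [this]
    exact MeasurableSet.iUnion fun n => MeasurableSet.iUnion fun _ =>
      measurableSet_le (hmeas n) measurable_const
  have hmono : Antitone fun L => (S L)ᶜ := fun L L' h => Set.compl_subset_compl.2
    fun y ⟨n, h1, h2, h3⟩ => ⟨n, h1, h2.trans h, h3⟩
  have hlim : Tendsto (fun L => μ.real (S L)ᶜ) atTop (𝓝 0) := by
    have h := tendsto_measure_iInter_atTop (μ := μ) (fun L => (hSm L).compl.nullMeasurableSet)
      hmono ⟨0, measure_ne_top _ _⟩
    have h0 : μ (⋂ L, (S L)ᶜ) = 0 := by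
      rw [measure_eq_zero_iff_ae_notMem]
      filter_upwards [hd] with x ⟨n, h1, h2⟩ hx
      exact Set.mem_iInter.1 hx n ⟨n, h1, le_rfl, h2⟩
    rw [h0] at h
    exact (ENNReal.tendsto_toReal ENNReal.zero_ne_top).comp h
  have hE : ∀ L N : ℕ, s * N ≤ d * N + (C + |d|) * (N * μ.real (S L)ᶜ) + (C + |d|) * L := by
    intro L N
    refine (hs N).trans ?_
    have hind : ∀ i, Integrable (fun x => (S L)ᶜ.indicator (fun _ => (1 : ℝ)) (T^[i] x)) μ :=
      fun i => Integrable.of_bound (((measurable_const.indicator (hSm L).compl).comp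
        (hT.iterate i).measurable).aestronglyMeasurable) 1
        (Eventually.of_forall fun x => by
          refine (norm_indicator_le_norm_self _ _).trans ?_
          simp)
    have hsumint := integrable_finsetSum (Finset.range N) fun i _ => hind i
    have key : ∫ x, a N x ∂μ ≤ ∫ x, (d * N + (C + |d|) * ∑ i ∈ Finset.range N,
        (S L)ᶜ.indicator (fun _ => (1 : ℝ)) (T^[i] x) + (C + |d|) * L) ∂μ := by
      refine integral_mono_ae (integrable_of_linear_bound hmeas hbd N)
        (((integrable_const _).add (hsumint.const_mul _)).add (integrable_const _)) ?_
      filter_upwards [ae_forall_iterate hT hbd] with x hx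
      exact subadditive_le_of_block_cover hsub d L N x hx
    refine key.trans (le_of_eq ?_)
    rw [integral_add (f := fun x => d * N + (C + |d|) * ∑ i ∈ Finset.range N,
        (S L)ᶜ.indicator (fun _ => (1 : ℝ)) (T^[i] x))
        ((integrable_const _).add (hsumint.const_mul _)) (integrable_const _),
      integral_add (integrable_const _) (hsumint.const_mul _), integral_const_mul (C + |d|)
        (fun x => ∑ i ∈ Finset.range N, (S L)ᶜ.indicator (fun _ => (1 : ℝ)) (T^[i] x)),
      integral_finsetSum _ fun i _ => hind i]
    have : ∀ i, ∫ x, (S L)ᶜ.indicator (fun _ => (1 : ℝ)) (T^[i] x) ∂μ = μ.real (S L)ᶜ := fun i => by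
      rw [integral_iterate_eq hT (measurable_const.indicator (hSm L).compl),
        integral_indicator (hSm L).compl]
      simp
    simp [this]
  have hL : ∀ L, s ≤ d + (C + |d|) * μ.real (S L)ᶜ := by
    intro L
    have h1 : Tendsto (fun N : ℕ => d + (C + |d|) * μ.real (S L)ᶜ + ((C + |d|) * L) / (N : ℝ)) atTop
        (𝓝 (d + (C + |d|) * μ.real (S L)ᶜ + 0)) :=
      tendsto_const_nhds.add (tendsto_const_div_atTop_nhds_zero_nat _)
    rw [add_zero] at h1
    refine ge_of_tendsto h1 ?_
    filter_upwards [eventually_gt_atTop 0] with N hN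
    have hN' : (0 : ℝ) < N := by exact_mod_cast hN
    have := hE L N
    rw [← mul_le_mul_iff_left₀ hN']
    field_simp
    linarith
  have h2 : Tendsto (fun L => d + (C + |d|) * μ.real (S L)ᶜ) atTop (𝓝 (d + (C + |d|) * 0)) :=
    tendsto_const_nhds.add (hlim.const_mul _)
  rw [mul_zero, add_zero] at h2
  exact ge_of_tendsto h2 (Eventually.of_forall hL)

/-- The lower half of Kingman's theorem. The set where the lower limit of `aₙ / n` is at most `c`
contains its preimage under `T`, so it is null or conull by ergodicity; if it were conull, almost
every point would start a block of average less than `s`. -/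
theorem ae_eventually_le_of_lt (hT : Ergodic T μ) (hmeas : ∀ n, Measurable (a n))
    (hsub : ∀ m n x, a (m + n) x ≤ a m x + a n (T^[m] x))
    (hbd : ∀ᵐ x ∂μ, ∀ n, |a n x| ≤ C * n) {s c : ℝ} (hs : ∀ n : ℕ, s * n ≤ ∫ x, a n x ∂μ)
    (hc : c < s) : ∀ᵐ x ∂μ, ∀ᶠ n : ℕ in atTop, c * n ≤ a n x := by
  set B : Set Ω := {x | ∀ k : ℕ, ∃ᶠ n : ℕ in atTop, a n x < (c + 1 / ((k : ℝ) + 1)) * n} with hB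
  have hBm : MeasurableSet B := by
    have : B = ⋂ k : ℕ, ⋂ N : ℕ, ⋃ n : ℕ, ⋃ (_ : N ≤ n),
        {x | a n x < (c + 1 / ((k : ℝ) + 1)) * n} := by
      ext x; simp [hB, frequently_atTop]
    rw [this]
    exact MeasurableSet.iInter fun k => MeasurableSet.iInter fun N => MeasurableSet.iUnion fun n =>
      MeasurableSet.iUnion fun _ => measurableSet_lt (hmeas n) measurable_const
  have hinv : T ⁻¹' B ⊆ B := by
    intro x hx k
    have hk : c + 1 / (((k + 1 : ℕ) : ℝ) + 1) < c + 1 / ((k : ℝ) + 1) := by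
      push_cast
      gcongr
      linarith
    set c₁ := c + 1 / (((k + 1 : ℕ) : ℝ) + 1)
    set c₂ := c + 1 / ((k : ℝ) + 1)
    have hev : ∀ᶠ n : ℕ in atTop, a 1 x + |c₂| ≤ (c₂ - c₁) * n :=
      (tendsto_natCast_atTop_atTop.const_mul_atTop (sub_pos.2 hk)).eventually_ge_atTop _
    refine frequently_atTop.2 fun N => ?_
    obtain ⟨n, hn, h1, h2⟩ := frequently_atTop.1 ((hx (k + 1)).and_eventually hev) N
    refine ⟨1 + n, by omega, ?_⟩
    have h3 := hsub 1 n x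
    simp only [Function.iterate_one] at h3
    have h4 := neg_abs_le c₂
    push_cast
    change a n (T x) < c₁ * n at h1
    linarith
  rcases hT.ae_empty_or_univ_of_preimage_ae_le hBm.nullMeasurableSet
    (Eventually.of_forall hinv) with h | h
  · have h' : ∀ᵐ x ∂μ, x ∉ B := by
      rw [ae_eq_empty] at h
      exact measure_eq_zero_iff_ae_notMem.1 h
    filter_upwards [h'] with x hx
    simp only [hB, Set.mem_ofPred_eq, not_forall, not_frequently, not_lt] at hx
    obtain ⟨k, hk⟩ := hx
    filter_upwards [hk] with n hn
    refine le_trans ?_ hn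
    gcongr
    have : (0 : ℝ) ≤ 1 / ((k : ℝ) + 1) := by positivity
    linarith
  · exfalso
    have h' : ∀ᵐ x ∂μ, x ∈ B := eventuallyEq_univ.1 h
    obtain ⟨k, hk⟩ := exists_nat_one_div_lt (sub_pos.2 hc)
    have := le_of_ae_exists_block hT.toMeasurePreserving hmeas hsub hbd (d := c + 1 / ((k : ℝ) + 1))
      hs (h'.mono fun x hx => by
        obtain ⟨n, h1, h2⟩ := ((hx k).and_eventually (eventually_ge_atTop 1)).exists
        exact ⟨n, h2, h1.le⟩)
    linarith

/-- The upper half of Birkhoff's theorem for a bounded function: the lower half of Kingman's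
theorem for the additive process of the opposite function. -/
theorem ae_eventually_birkhoffSum_le (hT : Ergodic T μ) {f : Ω → ℝ} (hf : Measurable f)
    (hC : ∀ᵐ x ∂μ, |f x| ≤ C) {c : ℝ} (hc : ∫ x, f x ∂μ < c) :
    ∀ᵐ x ∂μ, ∀ᶠ n : ℕ in atTop, ∑ i ∈ Finset.range n, f (T^[i] x) ≤ c * n := by
  have hint : ∀ i, Integrable (fun x => f (T^[i] x)) μ := fun i =>
    Integrable.of_bound (hf.comp (hT.toMeasurePreserving.iterate i).measurable).aestronglyMeasurable
      C ((hT.toMeasurePreserving.iterate i).quasiMeasurePreserving.ae hC)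
  have key := ae_eventually_le_of_lt (a := fun n x => -∑ i ∈ Finset.range n, f (T^[i] x)) (C := C)
    (s := -∫ x, f x ∂μ) (c := -c) hT
    (fun n => (Finset.measurable_sum _ fun i _ =>
      hf.comp (hT.toMeasurePreserving.iterate i).measurable).neg)
    (fun m n x => by
      rw [Finset.sum_range_add]
      simp only [← Function.iterate_add_apply, add_comm m]
      linarith)
    (by
      filter_upwards [ae_forall_iterate hT.toMeasurePreserving hC] with x hx n
      rw [abs_neg]
      refine (Finset.abs_sum_le_sum_abs _ _).trans ((Finset.sum_le_sum fun i _ => hx i).trans ?_)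
      simp [mul_comm])
    (fun n => by
      rw [integral_neg, integral_finsetSum _ fun i _ => hint i]
      simp [integral_iterate_eq hT.toMeasurePreserving hf, mul_comm])
    (neg_lt_neg hc)
  filter_upwards [key] with x hx
  filter_upwards [hx] with n hn
  linarith

/-- The upper half of Kingman's theorem. Birkhoff's theorem applies to `a (k + 1)`, whose sums along
the orbit dominate the telescoping sum of the differences `a (i + k + 1) - a i`. -/
theorem ae_eventually_le_of_integral_lt (hT : Ergodic T μ) (hmeas : ∀ n, Measurable (a n))
    (hsub : ∀ m n x, a (m + n) x ≤ a m x + a n (T^[m] x))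
    (hbd : ∀ᵐ x ∂μ, ∀ n, |a n x| ≤ C * n) {c : ℝ} (k : ℕ) (hc : ∫ x, a (k + 1) x ∂μ < c * (k + 1)) :
    ∀ᵐ x ∂μ, ∀ c', c < c' → ∀ᶠ n : ℕ in atTop, a n x ≤ c' * n := by
  filter_upwards [ae_eventually_birkhoffSum_le hT (hmeas (k + 1))
      (hbd.mono fun x hx => hx (k + 1)) hc,
    ae_forall_iterate hT.toMeasurePreserving hbd] with x hx hb c' hc'
  have hC : 0 ≤ C := by
    have h := (abs_nonneg _).trans (hb 0 1)
    simpa using h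
  have htel : ∀ n, ∑ j ∈ Finset.range (k + 1), (a (n + j) x - a j x)
      ≤ ∑ i ∈ Finset.range n, a (k + 1) (T^[i] x) := by
    intro n
    induction n with
    | zero => simp
    | succ n ih =>
      rw [Finset.sum_range_succ _ n]
      have h1 := hsub n (k + 1) x
      have h2 : ∑ j ∈ Finset.range (k + 1), (a (n + 1 + j) x - a j x)
          = ∑ j ∈ Finset.range (k + 1), (a (n + j) x - a j x) + a (n + (k + 1)) x - a n x := by
        simp only [Finset.sum_sub_distrib]
        have h3 : ∑ j ∈ Finset.range (k + 1), a (n + 1 + j) x + a n x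
            = ∑ j ∈ Finset.range (k + 1), a (n + j) x + a (n + (k + 1)) x := by
          rw [← Finset.sum_range_succ (fun j => a (n + j) x), Finset.sum_range_succ' _ (k + 1)]
          simp [add_assoc, add_comm 1]
        linarith
      linarith
  have hkey : ∀ n, ((k : ℝ) + 1) * a (n + k) x
      ≤ ∑ i ∈ Finset.range n, a (k + 1) (T^[i] x) + ((k : ℝ) + 1) * (2 * C * k) := by
    intro n
    have h1 : ∀ j ∈ Finset.range (k + 1), a (n + k) x - 2 * C * k ≤ a (n + j) x - a j x := by
      intro j hj
      have hj' : j ≤ k := by simpa [Nat.lt_succ_iff] using hj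
      obtain ⟨l, rfl⟩ : ∃ l, k = j + l := ⟨k - j, by omega⟩
      have h1 := hsub (n + j) l x
      have h2 := (le_abs_self _).trans (hb (n + j) l)
      have h3 := (le_abs_self _).trans (hb 0 j)
      simp only [Function.iterate_zero, id_eq] at h3
      rw [← add_assoc]
      push_cast
      have : 0 ≤ C * (j : ℝ) := by positivity
      have : 0 ≤ C * (l : ℝ) := by positivity
      linarith
    have h2 := (Finset.sum_le_sum h1).trans (htel n)
    simp only [Finset.sum_const, Finset.card_range, nsmul_eq_mul] at h2
    push_cast at h2
    linarith
  have hev : ∀ᶠ n : ℕ in atTop, 2 * C * k + |c'| * k ≤ (c' - c) * n :=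
    (tendsto_natCast_atTop_atTop.const_mul_atTop (sub_pos.2 hc')).eventually_ge_atTop _
  have h := hx.and hev
  obtain ⟨N, hN⟩ := eventually_atTop.1 h
  refine eventually_atTop.2 ⟨N + k, fun m hm => ?_⟩
  obtain ⟨n, rfl⟩ : ∃ n, m = n + k := ⟨m - k, by omega⟩
  obtain ⟨h1, h2⟩ := hN n (by omega)
  have hk0 : (0 : ℝ) < (k : ℝ) + 1 := by positivity
  have h3 : ((k : ℝ) + 1) * a (n + k) x ≤ (k + 1) * (c * n + 2 * C * k) := by
    linarith [hkey n]
  have h4 := le_of_mul_le_mul_left h3 hk0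
  have h5 : -|c'| * k ≤ c' * k := by
    gcongr
    exact neg_abs_le c'
  push_cast
  linarith

/-- Kingman's theorem for an ergodic transformation and a subadditive process of linear growth.
The limit `s` is the infimum of the means `(∫ aₙ) / n`. -/
theorem exists_tendsto_div_of_subadditive (hT : Ergodic T μ) (hmeas : ∀ n, Measurable (a n))
    (hsub : ∀ m n x, a (m + n) x ≤ a m x + a n (T^[m] x))
    (hbd : ∀ᵐ x ∂μ, ∀ n, |a n x| ≤ C * n) :
    ∃ s : ℝ, (∀ᵐ x ∂μ, Tendsto (fun n : ℕ => a n x / n) atTop (𝓝 s)) ∧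
      Tendsto (fun n : ℕ => eLpNorm (fun x => a n x / n - s) 1 μ) atTop (𝓝 0) ∧
      ∀ K : ℝ, (∀ n : ℕ, K * n ≤ ∫ x, a n x ∂μ) → K ≤ s := by
  set u : ℕ → ℝ := fun n => (∫ x, a (n + 1) x ∂μ) / ((n : ℝ) + 1) with hu
  have hint := integrable_of_linear_bound hmeas hbd
  have habs : ∀ n, |∫ x, a n x ∂μ| ≤ C * n := fun n => by
    have := norm_integral_le_of_norm_le_const (μ := μ) (f := a n) (C := C * n)
      (hbd.mono fun _ hx => hx n)
    simpa using this
  have hulow : ∀ n, -C ≤ u n := fun n => by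
    have h1 := neg_le_of_abs_le (habs (n + 1))
    rw [hu, le_div_iff₀ (by positivity)]
    push_cast at h1
    linarith
  have hbdd : BddBelow (Set.range u) := ⟨-C, by rintro _ ⟨n, rfl⟩; exact hulow n⟩
  set s := ⨅ n, u n with hs
  have hsle : ∀ n : ℕ, s * n ≤ ∫ x, a n x ∂μ := by
    rintro (_ | n)
    · have h0 := habs 0
      simp only [Nat.cast_zero, mul_zero] at h0 ⊢
      rw [abs_nonpos_iff.1 h0]
    · have h1 := ciInf_le hbdd n
      have h2 := (le_div_iff₀ (by positivity)).1 h1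
      push_cast
      exact h2
  have hae : ∀ᵐ x ∂μ, Tendsto (fun n : ℕ => a n x / n) atTop (𝓝 s) := by
    have hlow : ∀ᵐ x ∂μ, ∀ j : ℕ, ∀ᶠ n : ℕ in atTop, (s - 1 / ((j : ℝ) + 1)) * n ≤ a n x :=
      ae_all_iff.2 fun j => ae_eventually_le_of_lt hT hmeas hsub hbd hsle (by
        have : (0 : ℝ) < 1 / ((j : ℝ) + 1) := by positivity
        linarith)
    have hup : ∀ᵐ x ∂μ, ∀ j : ℕ, ∀ᶠ n : ℕ in atTop, a n x ≤ (s + 2 / ((j : ℝ) + 1)) * n := by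
      refine ae_all_iff.2 fun j => ?_
      have hj : (0 : ℝ) < 1 / ((j : ℝ) + 1) := by positivity
      obtain ⟨k, hk⟩ := exists_lt_of_ciInf_lt (show ⨅ n, u n < s + 1 / ((j : ℝ) + 1) by linarith)
      rw [hu, div_lt_iff₀ (by positivity)] at hk
      filter_upwards [ae_eventually_le_of_integral_lt hT hmeas hsub hbd k hk] with x hx
      refine hx _ ?_
      rw [← one_add_one_eq_two, add_div]
      linarith
    filter_upwards [hlow, hup] with x h1 h2
    refine tendsto_order.2 ⟨fun c hc => ?_, fun c hc => ?_⟩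
    · obtain ⟨j, hj⟩ := exists_nat_one_div_lt (sub_pos.2 hc)
      filter_upwards [h1 j, eventually_gt_atTop 0] with n hn hn0
      have hn0' : (0 : ℝ) < n := by exact_mod_cast hn0
      rw [lt_div_iff₀ hn0']
      refine lt_of_lt_of_le ?_ hn
      gcongr
      linarith
    · obtain ⟨j, hj⟩ := exists_nat_one_div_lt (half_pos (sub_pos.2 hc))
      filter_upwards [h2 j, eventually_gt_atTop 0] with n hn hn0
      have hn0' : (0 : ℝ) < n := by exact_mod_cast hn0
      rw [div_lt_iff₀ hn0']
      refine lt_of_le_of_lt hn ?_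
      gcongr
      have : 2 / ((j : ℝ) + 1) = 2 * (1 / ((j : ℝ) + 1)) := by ring
      linarith
  refine ⟨s, hae, ?_, fun K hK => le_ciInf fun n => ?_⟩
  · have hlim : Tendsto (fun n : ℕ => ∫⁻ x, ‖a n x / n - s‖ₑ ∂μ) atTop (𝓝 (∫⁻ _, 0 ∂μ)) := by
      refine tendsto_lintegral_of_dominated_convergence (fun _ => ENNReal.ofReal (C + |s|))
        (fun n => (((hmeas n).div_const _).sub_const _).enorm) (fun n => ?_) ?_ ?_
      · filter_upwards [hbd] with x hx
        rw [← ofReal_norm]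
        refine ENNReal.ofReal_le_ofReal ?_
        have hC : 0 ≤ C := by
          have h := (abs_nonneg _).trans (hx 1)
          simpa using h
        refine (norm_sub_le _ _).trans (add_le_add ?_ le_rfl)
        rw [Real.norm_eq_abs, abs_div, Nat.abs_cast]
        rcases Nat.eq_zero_or_pos n with rfl | hn
        · simpa using hC
        · rw [div_le_iff₀ (by exact_mod_cast hn)]
          exact hx n
      · simp
      · filter_upwards [hae] with x hx
        have : Tendsto (fun n : ℕ => ‖a n x / n - s‖ₑ) atTop (𝓝 ‖s - s‖ₑ) :=
          (hx.sub_const s).enorm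
        simpa using this
    simpa [eLpNorm_one_eq_lintegral_enorm] using hlim
  · have h1 := hK (n + 1)
    rw [hu, le_div_iff₀ (by positivity)]
    push_cast at h1
    exact h1

end Subadditive
/-! ### Simple random walk on a fixed graph -/

/-- The sequence `y, x₀, x₁, …`. -/
def consSeq {α : Type*} (y : α) (x : ℕ → α) : ℕ → α
  | 0 => y
  | n + 1 => x n

/-- The first `n + 1` terms of a sequence. -/
def initSeg {α : Type*} (n : ℕ) (x : ℕ → α) : Fin (n + 1) → α := fun i => x i

@[simp] theorem consSeq_zero {α : Type*} (y : α) (x : ℕ → α) : consSeq y x 0 = y := rfl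

@[simp] theorem consSeq_succ {α : Type*} (y : α) (x : ℕ → α) (n : ℕ) :
    consSeq y x (n + 1) = x n := rfl

theorem measurable_consSeq {α : Type*} [MeasurableSpace α] (y : α) :
    Measurable (consSeq y : (ℕ → α) → ℕ → α) := by
  refine measurable_pi_iff.2 fun n => ?_
  cases n with
  | zero => exact measurable_const
  | succ n => exact measurable_pi_apply n

theorem measurable_initSeg {α : Type*} [MeasurableSpace α] (n : ℕ) :
    Measurable (initSeg n : (ℕ → α) → Fin (n + 1) → α) :=
  measurable_pi_iff.2 fun _ => measurable_pi_apply _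

/-- Finite measures on sequences are determined by their finite-dimensional marginals. -/
theorem measure_eq_of_initSeg {α : Type*} [MeasurableSpace α] [Countable α]
    [MeasurableSingletonClass α] {μ ν : Measure (ℕ → α)} [IsFiniteMeasure μ] [IsFiniteMeasure ν]
    (h : ∀ n (a : Fin (n + 1) → α), μ (initSeg n ⁻¹' {a}) = ν (initSeg n ⁻¹' {a})) : μ = ν := by
  have hmap : ∀ n, μ.map (initSeg n) = ν.map (initSeg n) := fun n => by
    refine Measure.ext_of_singleton fun a => ?_
    rw [Measure.map_apply (measurable_initSeg n) (measurableSet_singleton a),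
      Measure.map_apply (measurable_initSeg n) (measurableSet_singleton a), h]
  have hν : IsProjectiveLimit ν (fun I : Finset ℕ => ν.map I.restrict) := fun _ => rfl
  have hμ : IsProjectiveLimit μ (fun I : Finset ℕ => ν.map I.restrict) := fun I => by
    have hI : ∀ i : I, (i : ℕ) < I.sup id + 1 := fun i =>
      Nat.lt_succ_of_le (Finset.le_sup (f := id) i.2)
    have hcomp : (I.restrict : (ℕ → α) → _) =
        (fun (b : Fin (I.sup id + 1) → α) (i : I) => b ⟨i, hI i⟩) ∘ initSeg (I.sup id) := rfl
    have hm : Measurable (fun (b : Fin (I.sup id + 1) → α) (i : I) => b ⟨i, hI i⟩) :=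
      measurable_pi_iff.2 fun _ => measurable_pi_apply _
    change μ.map I.restrict = ν.map I.restrict
    rw [hcomp, ← Measure.map_map hm (measurable_initSeg _),
      ← Measure.map_map hm (measurable_initSeg _), hmap]
  exact hμ.unique hν

namespace LFGraph

variable (G : LFGraph)

theorem mem_nbrs {u v : G.V} : v ∈ G.nbrs u ↔ G.graph.Adj u v := by
  simp [nbrs]

open scoped Classical in
theorem step_apply (u v : G.V) : G.step u v =
    if G.graph.Adj u v ∨ (u = v ∧ ∀ w, ¬ G.graph.Adj u w) then ((max 1 (G.deg u) : ℕ) : ENNReal)⁻¹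
    else 0 := by
  unfold step
  have hne : (G.nbrs u).Nonempty ↔ ∃ w, G.graph.Adj u w :=
    exists_congr fun w => G.mem_nbrs
  split_ifs with h1 h2 h2
  · rw [PMF.uniformOfFinset_apply]
    have hv : v ∈ G.nbrs u := by
      rcases h2 with h2 | h2
      · exact G.mem_nbrs.2 h2
      · exact absurd (hne.1 h1) (by simpa using h2.2)
    have hmax : max 1 (G.deg u) = (G.nbrs u).card := max_eq_right (Finset.card_pos.2 h1)
    rw [if_pos hv, hmax]
  · rw [PMF.uniformOfFinset_apply, if_neg]
    exact fun h => h2 (Or.inl (G.mem_nbrs.1 h))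
  · have hd : G.deg u = 0 := by
      rw [deg, Finset.card_eq_zero]
      exact Finset.not_nonempty_iff_eq_empty.1 h1
    have huv : u = v := by
      rcases h2 with h2 | h2
      · exact absurd (hne.2 ⟨v, h2⟩) h1
      · exact h2.1
    rw [hd, huv, PMF.pure_apply, if_pos rfl]
    simp
  · rw [hne, not_exists] at h1
    rw [PMF.pure_apply, if_neg]
    exact fun h => h2 (Or.inr ⟨h.symm, h1⟩)

theorem step_ne_zero_iff {u v : G.V} :
    G.step u v ≠ 0 ↔ G.graph.Adj u v ∨ (u = v ∧ ∀ w, ¬ G.graph.Adj u w) := by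
  classical
  rw [step_apply]
  split_ifs with h
  · exact iff_of_true (by simp) h
  · exact iff_of_false (by simp) h

/-- Simple random walk is reversible for the degrees (with the degree of an isolated vertex read
as one). -/
theorem step_eq_conductance (u v : G.V) : ∃ c : ENNReal,
    G.step u v = c * ((max 1 (G.deg u) : ℕ) : ENNReal)⁻¹ ∧
    G.step v u = c * ((max 1 (G.deg v) : ℕ) : ENNReal)⁻¹ := by
  classical
  have hsymm : (G.graph.Adj v u ∨ (v = u ∧ ∀ w, ¬ G.graph.Adj v w)) ↔
      (G.graph.Adj u v ∨ (u = v ∧ ∀ w, ¬ G.graph.Adj u w)) := by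
    rw [G.graph.adj_comm]
    refine or_congr_right ⟨?_, ?_⟩ <;> rintro ⟨rfl, h⟩ <;> exact ⟨rfl, h⟩
  refine ⟨if G.graph.Adj u v ∨ (u = v ∧ ∀ w, ¬ G.graph.Adj u w) then 1 else 0, ?_, ?_⟩
  · rw [step_apply]; split_ifs <;> simp
  · rw [step_apply, if_congr hsymm rfl rfl]; split_ifs <;> simp

theorem lintegral_step (u : G.V) (f : G.V → ENNReal) :
    ∫⁻ v, f v ∂(G.step u).toMeasure = ∑' v, G.step u v * f v := by
  rw [lintegral_countable']
  refine tsum_congr fun v => ?_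
  rw [PMF.toMeasure_apply_singleton _ _ (measurableSet_singleton v), mul_comm]

instance (x : G.V) : IsProbabilityMeasure (G.srw x) := by
  unfold srw; infer_instance

open scoped Classical in
/-- The probability that simple random walk started at `x` follows the finite path `a`. -/
noncomputable def pathProb (x : G.V) {n : ℕ} (a : Fin (n + 1) → G.V) : ENNReal :=
  (if a 0 = x then 1 else 0) * ∏ i : Fin n, G.step (a i.castSucc) (a i.succ)

theorem srw_map_zero (x : G.V) : (G.srw x).map (fun z => z 0) = Measure.dirac x := by
  have h : (fun z : ℕ → G.V => z 0) =
      (fun h : Finset.Iic 0 → G.V => h ⟨0, Finset.mem_Iic.2 le_rfl⟩) ∘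
        Preorder.frestrictLe (π := fun _ => G.V) 0 := rfl
  have hm : Measurable (fun h : Finset.Iic 0 → G.V => h ⟨0, Finset.mem_Iic.2 le_rfl⟩) :=
    measurable_pi_apply _
  rw [h, ← Measure.map_map hm (by fun_prop), srw, Kernel.trajMeasure,
    Measure.map_comp _ _ (by fun_prop), Kernel.traj_map_frestrictLe, Kernel.partialTraj_self,
    Measure.id_comp, Measure.map_map hm (by fun_prop)]
  exact Measure.map_id

theorem srw_initSeg (x : G.V) (n : ℕ) (a : Fin (n + 1) → G.V) :
    G.srw x (initSeg n ⁻¹' {a}) = G.pathProb x a := by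
  classical
  induction n with
  | zero =>
    have h : (initSeg 0 ⁻¹' {a} : Set (ℕ → G.V)) = (fun z => z 0) ⁻¹' {a 0} := by
      ext z
      simp only [Set.mem_preimage, Set.mem_singleton_iff]
      refine ⟨fun h => by rw [← h]; rfl, fun h => funext fun i => ?_⟩
      rw [show i = 0 from Subsingleton.elim (α := Fin 1) i 0]; exact h
    rw [h, ← Measure.map_apply (measurable_pi_apply 0) (measurableSet_singleton _), srw_map_zero,
      Measure.dirac_apply' _ (measurableSet_singleton _)]
    simp [pathProb, Set.indicator_apply, eq_comm]
  | succ n ih =>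
    set b : Finset.Iic n → G.V := fun i =>
      a ⟨i, (Nat.lt_succ_of_le (Finset.mem_Iic.1 i.2)).trans (Nat.lt_succ_self _)⟩ with hb
    have h1 : (initSeg (n + 1) ⁻¹' {a} : Set (ℕ → G.V)) =
        (fun z => (Preorder.frestrictLe (π := fun _ => G.V) n z, z (n + 1))) ⁻¹'
          ({b} ×ˢ {a (Fin.last (n + 1))}) := by
      ext z
      simp only [Set.mem_preimage, Set.mem_singleton_iff, Set.mem_prod]
      constructor
      · rintro rfl
        exact ⟨rfl, rfl⟩
      · rintro ⟨h1, h2⟩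
        funext i
        refine Fin.lastCases h2 (fun i => ?_) i
        exact congrFun h1 ⟨i, Finset.mem_Iic.2 (Nat.lt_succ_iff.1 i.2)⟩
    have h2 : (Preorder.frestrictLe (π := fun _ => G.V) n) ⁻¹' {b} =
        (initSeg n ⁻¹' {fun i => a i.castSucc} : Set (ℕ → G.V)) := by
      ext z
      simp only [Set.mem_preimage, Set.mem_singleton_iff]
      constructor
      · intro h
        funext i
        exact congrFun h ⟨i, Finset.mem_Iic.2 (Nat.lt_succ_iff.1 i.2)⟩
      · intro h
        funext i
        exact congrFun h ⟨i, Nat.lt_succ_iff.2 (Finset.mem_Iic.1 i.2)⟩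
    have hm := Kernel.map_frestrictLe_trajMeasure_compProd_eq_map_trajMeasure
      (X := fun _ => G.V) (κ := fun n => G.historyKernel n) (μ₀ := Measure.dirac x) (a := n)
    rw [h1, ← Measure.map_apply (by fun_prop)
      ((measurableSet_singleton _).prod (measurableSet_singleton _)), srw, ← hm,
      Measure.compProd_apply_prod (measurableSet_singleton _) (measurableSet_singleton _),
      Measure.restrict_singleton, lintegral_smul_measure, lintegral_dirac,
      Measure.map_apply (by fun_prop) (measurableSet_singleton _), h2, smul_eq_mul]
    change G.srw x _ * _ = _
    rw [ih]
    have hk : G.historyKernel n b {a (Fin.last (n + 1))} =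
        G.step (a (Fin.last n).castSucc) (a (Fin.last n).succ) := by
      change (G.step _).toMeasure _ = _
      rw [PMF.toMeasure_apply_singleton _ _ (measurableSet_singleton _)]
      rfl
    rw [hk, pathProb, pathProb, Fin.prod_univ_castSucc, mul_assoc]
    rfl

theorem lintegral_initSeg (x : G.V) (n : ℕ) (f : (Fin (n + 1) → G.V) → ENNReal) :
    ∫⁻ z, f (initSeg n z) ∂(G.srw x) = ∑' a, f a * G.pathProb x a := by
  rw [← lintegral_map (measurable_of_countable f) (measurable_initSeg n), lintegral_countable']
  refine tsum_congr fun a => ?_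
  rw [Measure.map_apply (measurable_initSeg n) (measurableSet_singleton a), srw_initSeg]

/-- The Markov property of simple random walk at time one. -/
theorem srw_first_step (x : G.V) :
    G.srw x = Measure.sum (fun y => G.step x y • (G.srw y).map (consSeq x)) := by
  classical
  have hmass : (Measure.sum (fun y => G.step x y • (G.srw y).map (consSeq x))) Set.univ = 1 := by
    rw [Measure.sum_apply _ MeasurableSet.univ]
    simp [Measure.map_apply (measurable_consSeq x) MeasurableSet.univ, (G.step x).tsum_coe]
  have : IsFiniteMeasure (Measure.sum (fun y => G.step x y • (G.srw y).map (consSeq x))) :=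
    ⟨by rw [hmass]; exact ENNReal.one_lt_top⟩
  refine measure_eq_of_initSeg fun n a => ?_
  have hS : MeasurableSet (initSeg n ⁻¹' {a} : Set (ℕ → G.V)) :=
    measurable_initSeg n (measurableSet_singleton a)
  rw [srw_initSeg, Measure.sum_apply _ hS]
  simp only [Measure.smul_apply, smul_eq_mul, Measure.map_apply (measurable_consSeq x) hS]
  by_cases h0 : a 0 = x
  · cases n with
    | zero =>
      have : (consSeq x ⁻¹' (initSeg 0 ⁻¹' {a}) : Set (ℕ → G.V)) = Set.univ := by
        refine Set.eq_univ_of_forall fun z => ?_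
        refine funext fun i => ?_
        rw [show i = 0 from Subsingleton.elim (α := Fin 1) i 0, h0]; rfl
      simp [pathProb, h0, this, (G.step x).tsum_coe]
    | succ n =>
      have : (consSeq x ⁻¹' (initSeg (n + 1) ⁻¹' {a}) : Set (ℕ → G.V)) =
          initSeg n ⁻¹' {fun i => a i.succ} := by
        ext z
        simp only [Set.mem_preimage, Set.mem_singleton_iff]
        constructor
        · rintro rfl; rfl
        · intro h
          funext i
          refine Fin.cases h0.symm (fun i => ?_) i
          exact congrFun h i
      simp only [this, srw_initSeg, pathProb, h0, if_true, one_mul]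
      rw [tsum_eq_single (a 1)]
      · simp [Fin.prod_univ_succ, h0]
      · intro y hy
        simp [Ne.symm hy]
  · have : (consSeq x ⁻¹' (initSeg n ⁻¹' {a}) : Set (ℕ → G.V)) = ∅ := by
      refine Set.eq_empty_of_forall_notMem fun z hz => h0 ?_
      rw [← (show initSeg n (consSeq x z) = a from hz)]; rfl
    simp [pathProb, h0, this]

theorem lintegral_srw_first_step (x : G.V) {f : (ℕ → G.V) → ENNReal} (hf : Measurable f) :
    ∫⁻ z, f z ∂(G.srw x) = ∑' y, G.step x y * ∫⁻ z, f (consSeq x z) ∂(G.srw y) := by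
  conv_lhs => rw [srw_first_step]
  rw [lintegral_sum_measure]
  refine tsum_congr fun y => ?_
  rw [lintegral_smul_measure, lintegral_map hf (measurable_consSeq x), smul_eq_mul]

theorem srw_ae_zero (x : G.V) : ∀ᵐ z ∂(G.srw x), z 0 = x := by
  have h : ∀ᵐ y ∂((G.srw x).map (fun z => z 0)), y = x := by
    rw [srw_map_zero]
    exact (ae_dirac_iff (p := fun y => y = x) (measurableSet_singleton x)).2 rfl
  exact ae_of_ae_map (measurable_pi_apply 0).aemeasurable h

theorem srw_ae_step_ne_zero (x : G.V) : ∀ᵐ z ∂(G.srw x), ∀ n, G.step (z n) (z (n + 1)) ≠ 0 := by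
  classical
  refine ae_all_iff.2 fun n => ?_
  set f : (Fin (n + 2) → G.V) → ENNReal := fun a =>
    if G.step (a (Fin.last n).castSucc) (a (Fin.last n).succ) = 0 then 1 else 0 with hf
  have h0 : ∀ a : Fin (n + 2) → G.V, f a * G.pathProb x a = 0 := fun a => by
    by_cases h : G.step (a (Fin.last n).castSucc) (a (Fin.last n).succ) = 0
    · rw [pathProb, Fin.prod_univ_castSucc, h, mul_zero, mul_zero, mul_zero]
    · rw [hf]
      simp only [if_neg h, zero_mul]
  have h : ∫⁻ z, f (initSeg (n + 1) z) ∂(G.srw x) = 0 := by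
    rw [G.lintegral_initSeg x (n + 1) f]
    simp only [h0, tsum_zero]
  have hm : Measurable fun z : ℕ → G.V => f (initSeg (n + 1) z) :=
    (measurable_of_countable f).comp (measurable_initSeg (n + 1))
  filter_upwards [(lintegral_eq_zero_iff hm).1 h] with z hz hz0
  have h1 : f (initSeg (n + 1) z) = 1 := if_pos hz0
  rw [h1] at hz
  exact one_ne_zero hz

theorem dist_le_of_steps {z : ℕ → G.V} (hz : ∀ n, G.step (z n) (z (n + 1)) ≠ 0) (n : ℕ) :
    G.graph.dist (z 0) (z n) ≤ n := by
  induction n with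
  | zero => simp
  | succ n ih =>
    refine (G.connected.dist_triangle (v := z n)).trans (add_le_add ih ?_)
    rcases G.step_ne_zero_iff.1 (hz n) with h | h
    · exact (SimpleGraph.dist_eq_one_iff_adj.2 h).le
    · rw [h.1]; simp

theorem srw_initSeg_ne_zero {n : ℕ} {a : Fin (n + 1) → G.V}
    (ha : ∀ i : Fin n, G.step (a i.castSucc) (a i.succ) ≠ 0) :
    G.srw (a 0) (initSeg n ⁻¹' {a}) ≠ 0 := by
  rw [srw_initSeg, pathProb]
  simpa [Finset.prod_eq_zero_iff] using ha

/-- Along a closed path the degrees seen at the beginning and at the end of the steps have the same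
product. -/
theorem pathProb_rev (x : G.V) {n : ℕ} {a : Fin (n + 1) → G.V} (ha : a (Fin.last n) = a 0) :
    G.pathProb x (a ∘ Fin.rev) = G.pathProb x a := by
  classical
  cases n with
  | zero =>
    congr 1
    exact funext fun i => congrArg a (Subsingleton.elim (α := Fin 1) _ _)
  | succ m =>
    have h0 : (a ∘ Fin.rev) 0 = a 0 := by simpa using ha
    rw [pathProb, pathProb, h0]
    congr 1
    choose c hc1 hc2 using fun i : Fin (m + 1) => G.step_eq_conductance (a i.castSucc) (a i.succ)
    simp only [hc1, Finset.prod_mul_distrib]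
    have h1 : ∀ i : Fin (m + 1), G.step ((a ∘ Fin.rev) i.castSucc) ((a ∘ Fin.rev) i.succ) =
        G.step (a i.rev.succ) (a i.rev.castSucc) := fun i => by
      simp [Fin.rev_castSucc, Fin.rev_succ]
    simp only [h1]
    rw [Fintype.prod_equiv Fin.revPerm
      (fun i : Fin (m + 1) => G.step (a i.rev.succ) (a i.rev.castSucc))
      (fun i => G.step (a i.succ) (a i.castSucc)) (fun _ => rfl)]
    simp only [hc2, Finset.prod_mul_distrib]
    congr 1
    rw [Fin.prod_univ_castSucc, Fin.prod_univ_succ, mul_comm]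
    simp [← ha]

/-- Conditionally on returning to its starting point at time `n`, simple random walk has the same
law as its time reversal. -/
theorem lintegral_loop_rev (x : G.V) (n : ℕ) (g : (ℕ → G.V) → ENNReal) :
    ∫⁻ z, {z | z n = z 0}.indicator (fun z => g (fun i => z (n - i))) z ∂(G.srw x) =
      ∫⁻ z, {z | z n = z 0}.indicator (fun z => g (fun i => z (min i n))) z ∂(G.srw x) := by
  classical
  set e : (Fin (n + 1) → G.V) → ℕ → G.V :=
    fun a i => a ⟨min i n, Nat.lt_succ_of_le (min_le_right _ _)⟩ with he
  have h1 := G.lintegral_initSeg x n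
    (fun a => if a (Fin.last n) = a 0 then g (e (a ∘ Fin.rev)) else 0)
  have h2 := G.lintegral_initSeg x n (fun a => if a (Fin.last n) = a 0 then g (e a) else 0)
  have e1 : ∀ z : ℕ → G.V, {z : ℕ → G.V | z n = z 0}.indicator (fun z => g (fun i => z (n - i))) z =
      (fun a => if a (Fin.last n) = a 0 then g (e (a ∘ Fin.rev)) else 0) (initSeg n z) := by
    intro z
    rw [Set.indicator_apply]
    refine if_congr Iff.rfl ?_ rfl
    refine congrArg g (funext fun i => ?_)
    simp only [he, Function.comp, initSeg, Fin.val_rev]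
    congr 1
    omega
  have e2 : ∀ z : ℕ → G.V,
      {z : ℕ → G.V | z n = z 0}.indicator (fun z => g (fun i => z (min i n))) z =
      (fun a => if a (Fin.last n) = a 0 then g (e a) else 0) (initSeg n z) := fun z => by
    rw [Set.indicator_apply]
    rfl
  simp only [e1, e2]
  rw [h1, h2, ← (Equiv.arrowCongr (Fin.revPerm (n := n + 1)) (Equiv.refl G.V)).tsum_eq]
  refine tsum_congr fun a => ?_
  have hE : (Equiv.arrowCongr (Fin.revPerm (n := n + 1)) (Equiv.refl G.V)) a = a ∘ Fin.rev := by
    funext i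
    simp [Equiv.arrowCongr]
  rw [hE]
  have hrr : (a ∘ Fin.rev) ∘ Fin.rev = a := by
    funext i; simp
  rw [hrr]
  by_cases ha : a (Fin.last n) = a 0
  · rw [G.pathProb_rev x ha]
    simp [ha]
  · have ha' : a 0 ≠ a (Fin.last n) := Ne.symm ha
    simp [ha, ha']

variable {G} {H : LFGraph}

theorem deg_iso (φ : G.graph ≃g H.graph) (u : G.V) : H.deg (φ u) = G.deg u := by
  unfold deg
  refine (Finset.card_bij (fun v _ => φ v) (fun v hv => ?_) (fun v _ w _ h => φ.injective h)
    (fun v hv => ⟨φ.symm v, ?_, by simp⟩)).symm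
  · rw [mem_nbrs] at hv ⊢
    exact φ.map_adj_iff.2 hv
  · rw [mem_nbrs] at hv ⊢
    rw [← φ.map_adj_iff]
    simpa using hv

theorem step_iso (φ : G.graph ≃g H.graph) (u v : G.V) : H.step (φ u) (φ v) = G.step u v := by
  classical
  rw [step_apply, step_apply, deg_iso]
  refine if_congr ?_ rfl rfl
  rw [φ.map_adj_iff, φ.injective.eq_iff, φ.surjective.forall]
  simp only [φ.map_adj_iff]

theorem tsum_step_iso (φ : G.graph ≃g H.graph) (u : G.V) (f : H.V → ENNReal) :
    ∑' v, H.step (φ u) v * f v = ∑' v, G.step u v * f (φ v) := by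
  rw [← φ.toEquiv.tsum_eq]
  refine tsum_congr fun v => ?_
  change H.step (φ u) (φ v) * f (φ v) = _
  rw [step_iso]

theorem measurable_comp_iso (φ : G.graph ≃g H.graph) :
    Measurable (fun (z : ℕ → G.V) i => φ (z i)) :=
  measurable_pi_iff.2 fun i => (measurable_of_countable φ).comp (measurable_pi_apply i)

theorem srw_iso (φ : G.graph ≃g H.graph) (x : G.V) :
    (G.srw x).map (fun z i => φ (z i)) = H.srw (φ x) := by
  classical
  have := Measure.isProbabilityMeasure_map (μ := G.srw x) (measurable_comp_iso φ).aemeasurable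
  refine measure_eq_of_initSeg fun n a => ?_
  rw [Measure.map_apply (measurable_comp_iso φ)
    (measurable_initSeg n (measurableSet_singleton a)), srw_initSeg]
  obtain ⟨b, rfl⟩ : ∃ b : Fin (n + 1) → G.V, a = fun i => φ (b i) :=
    ⟨fun i => φ.symm (a i), by funext i; simp⟩
  have : (fun (z : ℕ → G.V) i => φ (z i)) ⁻¹' (initSeg n ⁻¹' {fun i => φ (b i)}) =
      initSeg n ⁻¹' {b} := by
    ext z
    simp only [Set.mem_preimage, Set.mem_singleton_iff]
    constructor
    · exact fun h => funext fun i => φ.injective (congrFun h i)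
    · rintro rfl; rfl
  rw [this, srw_initSeg, pathProb, pathProb]
  simp only [step_iso, φ.injective.eq_iff]

theorem lintegral_srw_iso (φ : G.graph ≃g H.graph) (x : G.V) {f : (ℕ → H.V) → ENNReal}
    (hf : Measurable f) :
    ∫⁻ z, f z ∂(H.srw (φ x)) = ∫⁻ z, f (fun i => φ (z i)) ∂(G.srw x) := by
  rw [← srw_iso, lintegral_map hf (measurable_comp_iso φ)]

end LFGraph
/-! ### The local topology on isomorphism classes -/

/-- `f` and `g` are mutually inverse isomorphisms between the balls of radius `r` around `x` in `G`
and around `y` in `H`; outside these balls their values are irrelevant. -/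
structure LocIso (G H : LFGraph) (x : G.V) (y : H.V) (r : ℕ) (f : G.V → H.V) (g : H.V → G.V) :
    Prop where
  map_root : f x = y
  maps : ∀ v, G.graph.dist x v ≤ r → H.graph.dist y (f v) ≤ r
  maps_inv : ∀ w, H.graph.dist y w ≤ r → G.graph.dist x (g w) ≤ r
  left_inv : ∀ v, G.graph.dist x v ≤ r → g (f v) = v
  right_inv : ∀ w, H.graph.dist y w ≤ r → f (g w) = w
  adj : ∀ u v, G.graph.dist x u ≤ r → G.graph.dist x v ≤ r →
    (H.graph.Adj (f u) (f v) ↔ G.graph.Adj u v)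

namespace LocIso

variable {G H K : LFGraph} {x : G.V} {y : H.V} {z : K.V} {r R : ℕ} {f : G.V → H.V} {g : H.V → G.V}
  {f' : H.V → K.V} {g' : K.V → H.V}

theorem symm (h : LocIso G H x y r f g) : LocIso H G y x r g f where
  map_root := by rw [← h.map_root, h.left_inv x (by simp)]
  maps := h.maps_inv
  maps_inv := h.maps
  left_inv := h.right_inv
  right_inv := h.left_inv
  adj u v hu hv := by
    rw [← h.adj _ _ (h.maps_inv u hu) (h.maps_inv v hv), h.right_inv u hu, h.right_inv v hv]

theorem trans (h : LocIso G H x y r f g) (h' : LocIso H K y z r f' g') :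
    LocIso G K x z r (f' ∘ f) (g ∘ g') where
  map_root := by simp [h.map_root, h'.map_root]
  maps v hv := h'.maps _ (h.maps v hv)
  maps_inv w hw := h.maps_inv _ (h'.maps_inv w hw)
  left_inv v hv := by simp [h'.left_inv _ (h.maps v hv), h.left_inv v hv]
  right_inv w hw := by simp [h.right_inv _ (h'.maps_inv w hw), h'.right_inv w hw]
  adj u v hu hv := by
    simp [h'.adj _ _ (h.maps u hu) (h.maps v hv), h.adj u v hu hv]

theorem dist_map_le_length (h : LocIso G H x y R f g) {u v : G.V} (p : G.graph.Walk u v)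
    (hp : G.graph.dist x u + p.length ≤ R) : H.graph.dist (f u) (f v) ≤ p.length := by
  induction p with
  | nil => simp
  | @cons u w v e p ih =>
    rw [SimpleGraph.Walk.length_cons] at hp ⊢
    have hw : G.graph.dist x w ≤ G.graph.dist x u + 1 :=
      (G.connected.dist_triangle (v := u)).trans
        (by rw [SimpleGraph.dist_eq_one_iff_adj.2 e])
    have h1 : H.graph.dist (f u) (f w) = 1 :=
      SimpleGraph.dist_eq_one_iff_adj.2 ((h.adj u w (by omega) (by omega)).2 e)
    have h2 := ih (by omega)
    have h3 := H.connected.dist_triangle (u := f u) (v := f w) (w := f v)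
    omega

theorem dist_map_le (h : LocIso G H x y R f g) {u v : G.V}
    (huv : G.graph.dist x u + G.graph.dist u v ≤ R) :
    H.graph.dist (f u) (f v) ≤ G.graph.dist u v := by
  obtain ⟨p, hp⟩ := G.connected.exists_walk_length_eq_dist u v
  rw [← hp] at huv ⊢
  exact h.dist_map_le_length p huv

/-- A local isomorphism preserves distances between vertices whose geodesics stay in the ball. -/
theorem dist_map (h : LocIso G H x y R f g) {u v : G.V}
    (huv : G.graph.dist x u + G.graph.dist u v ≤ R) :
    H.graph.dist (f u) (f v) = G.graph.dist u v := by
  have h1 := h.dist_map_le huv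
  have h2 : H.graph.dist y (f u) ≤ G.graph.dist x u := by
    have := h.dist_map_le (u := x) (v := u) (by simp; omega)
    rwa [h.map_root] at this
  have h3 := h.symm.dist_map_le (u := f u) (v := f v) (by omega)
  have h4 := G.connected.dist_triangle (u := x) (v := u) (w := v)
  rw [h.left_inv u (by omega), h.left_inv v (by omega)] at h3
  omega

/-- A local isomorphism restricts to smaller balls inside the given one, at other centres. -/
theorem restrict (h : LocIso G H x y R f g) {u : G.V} (hu : G.graph.dist x u + r ≤ R) :
    LocIso G H u (f u) r f g := by
  have hd : H.graph.dist y (f u) = G.graph.dist x u := by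
    have := h.dist_map (u := x) (v := u) (by simp; omega)
    rwa [h.map_root] at this
  have hG : ∀ v, G.graph.dist u v ≤ r → G.graph.dist x v ≤ R := fun v hv => by
    have := G.connected.dist_triangle (u := x) (v := u) (w := v)
    omega
  have hH : ∀ v, H.graph.dist (f u) v ≤ r → H.graph.dist y v ≤ R := fun v hv => by
    have := H.connected.dist_triangle (u := y) (v := f u) (w := v)
    omega
  refine ⟨rfl, fun v hv => ?_, fun w hw => ?_, fun v hv => h.left_inv v (hG v hv),
    fun w hw => h.right_inv w (hH w hw), fun v w hv hw => h.adj v w (hG v hv) (hG w hw)⟩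
  · rw [h.dist_map (by omega)]; exact hv
  · have := h.symm.dist_map (u := f u) (v := w) (by omega)
    rw [h.left_inv u (by omega)] at this
    omega

theorem mono (h : LocIso G H x y R f g) (hr : r ≤ R) : LocIso G H x y r f g := by
  have := h.restrict (u := x) (r := r) (by simpa using hr)
  rwa [h.map_root] at this

end LocIso

section Marked

variable {ι κ : Type} {o : ι} {idx : ι → ℕ} {o' : κ} {idx' : κ → ℕ}

/-- The index data of a local distance: the centre is the only index visible at radius zero, and
finitely many indices are visible at each radius. -/
structure IndexedAt (o : ι) (idx : ι → ℕ) : Prop where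
  eq_zero_iff : ∀ i, idx i = 0 ↔ i = o
  finite : ∀ r, {i | idx i ≤ r}.Finite

theorem IndexedAt.le (h : IndexedAt o idx) (r : ℕ) : idx o ≤ r := by
  rw [(h.eq_zero_iff o).2 rfl]; exact Nat.zero_le r

theorem agree_iff (h : IndexedAt o idx) {r : ℕ} {A B : Marked ι} :
    Agree o idx r A B ↔ ∃ f g, LocIso A.G B.G (A.mark o) (B.mark o) r f g ∧
      ∀ i, idx i ≤ r → ∀ v, A.G.graph.dist (A.mark o) v ≤ r → (v = A.mark i ↔ f v = B.mark i) := by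
  classical
  constructor
  · rintro ⟨φ, hφ⟩
    set f : A.G.V → B.G.V := fun v =>
      if hv : v ∈ A.G.ball (A.mark o) r then (φ ⟨v, hv⟩).1 else B.mark o with hf
    set g : B.G.V → A.G.V := fun v =>
      if hv : v ∈ B.G.ball (B.mark o) r then (φ.symm ⟨v, hv⟩).1 else A.mark o with hg
    have hfv : ∀ v (hv : v ∈ A.G.ball (A.mark o) r), f v = (φ ⟨v, hv⟩).1 := fun v hv => dif_pos hv
    have hgv : ∀ v (hv : v ∈ B.G.ball (B.mark o) r), g v = (φ.symm ⟨v, hv⟩).1 :=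
      fun v hv => dif_pos hv
    have hA : A.mark o ∈ A.G.ball (A.mark o) r := by simp [LFGraph.ball]
    refine ⟨f, g, ⟨?_, fun v hv => ?_, fun v hv => ?_, fun v hv => ?_, fun v hv => ?_,
      fun u v hu hv => ?_⟩, fun i hi v hv => ?_⟩
    · rw [hfv _ hA]
      exact (hφ o (h.le r) ⟨A.mark o, hA⟩).1 rfl
    · rw [hfv v hv]; exact (φ ⟨v, hv⟩).2
    · rw [hgv v hv]; exact (φ.symm ⟨v, hv⟩).2
    · rw [hfv v hv, hgv _ (φ ⟨v, hv⟩).2]; simp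
    · rw [hgv v hv, hfv _ (φ.symm ⟨v, hv⟩).2]; simp
    · rw [hfv u hu, hfv v hv]
      exact φ.map_adj_iff (v := ⟨u, hu⟩) (w := ⟨v, hv⟩)
    · rw [hfv v hv]
      exact hφ i hi ⟨v, hv⟩
  · rintro ⟨f, g, hL, hm⟩
    refine ⟨⟨⟨fun v => ⟨f v.1, hL.maps _ v.2⟩, fun w => ⟨g w.1, hL.maps_inv _ w.2⟩,
      fun v => Subtype.ext (hL.left_inv _ v.2), fun w => Subtype.ext (hL.right_inv _ w.2)⟩,
      fun {u v} => hL.adj _ _ u.2 v.2⟩, fun i hi v => hm i hi v.1 v.2⟩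

theorem Agree.symm (h : IndexedAt o idx) {r : ℕ} {A B : Marked ι} (hAB : Agree o idx r A B) :
    Agree o idx r B A := by
  rw [agree_iff h] at *
  obtain ⟨f, g, hL, hm⟩ := hAB
  refine ⟨g, f, hL.symm, fun i hi v hv => ?_⟩
  rw [hm i hi (g v) (hL.maps_inv v hv), hL.right_inv v hv]

theorem Agree.trans (h : IndexedAt o idx) {r : ℕ} {A B C : Marked ι} (hAB : Agree o idx r A B)
    (hBC : Agree o idx r B C) : Agree o idx r A C := by
  rw [agree_iff h] at *
  obtain ⟨f, g, hL, hm⟩ := hAB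
  obtain ⟨f', g', hL', hm'⟩ := hBC
  exact ⟨_, _, hL.trans hL', fun i hi v hv =>
    (hm i hi v hv).trans (hm' i hi (f v) (hL.maps v hv))⟩

theorem Agree.mono (h : IndexedAt o idx) {r R : ℕ} (hr : r ≤ R) {A B : Marked ι}
    (hAB : Agree o idx R A B) : Agree o idx r A B := by
  rw [agree_iff h] at *
  obtain ⟨f, g, hL, hm⟩ := hAB
  exact ⟨f, g, hL.mono hr, fun i hi v hv => hm i (hi.trans hr) v (hv.trans hr)⟩

theorem dist_iso {G H : LFGraph} (φ : G.graph ≃g H.graph) (u v : G.V) :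
    H.graph.dist (φ u) (φ v) = G.graph.dist u v := by
  have key : ∀ {G H : LFGraph} (φ : G.graph ≃g H.graph) (u v : G.V),
      H.graph.dist (φ u) (φ v) ≤ G.graph.dist u v := fun {G H} φ u v => by
    obtain ⟨p, hp⟩ := G.connected.exists_walk_length_eq_dist u v
    rw [← hp, ← SimpleGraph.Walk.length_map φ.toHom p]
    exact SimpleGraph.dist_le _
  refine le_antisymm (key φ u v) ?_
  simpa using key φ.symm (φ u) (φ v)

theorem Agree.of_iso (h : IndexedAt o idx) (r : ℕ) {A B : Marked ι} (φ : A.G.graph ≃g B.G.graph)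
    (hφ : ∀ i, φ (A.mark i) = B.mark i) : Agree o idx r A B := by
  rw [agree_iff h]
  refine ⟨φ, φ.symm, ⟨hφ o, fun v hv => ?_, fun w hw => ?_, by simp, by simp,
    fun u v _ _ => φ.map_adj_iff⟩, fun i _ v _ => ?_⟩
  · rwa [← hφ o, dist_iso]
  · rwa [← dist_iso φ, hφ o, RelIso.apply_symm_apply]
  · rw [← hφ i, φ.injective.eq_iff]

theorem cls_eq_iff {A B : Marked ι} :
    A.cls = B.cls ↔ ∃ φ : A.G.graph ≃g B.G.graph, ∀ i, φ (A.mark i) = B.mark i :=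
  Quotient.eq (r := isoSetoid ι)

@[simp] theorem cls_rep (q : MarkedClass ι) : q.rep.cls = q := Quotient.out_eq q

theorem exists_iso_rep_cls (A : Marked ι) :
    ∃ φ : A.cls.rep.G.graph ≃g A.G.graph, ∀ i, φ (A.cls.rep.mark i) = A.mark i :=
  cls_eq_iff.1 (cls_rep A.cls)

theorem agree_rep_cls (h : IndexedAt o idx) (r : ℕ) (A : Marked ι) :
    Agree o idx r A.cls.rep A := by
  obtain ⟨φ, hφ⟩ := exists_iso_rep_cls A
  exact Agree.of_iso h r φ hφ

theorem agree_rep_iff (h : IndexedAt o idx) {r : ℕ} {A B : Marked ι} :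
    Agree o idx r A.cls.rep B.cls.rep ↔ Agree o idx r A B :=
  ⟨fun hAB => ((agree_rep_cls h r A).symm h).trans h (hAB.trans h (agree_rep_cls h r B)),
    fun hAB => (agree_rep_cls h r A).trans h (hAB.trans h ((agree_rep_cls h r B).symm h))⟩

/-- At radius zero only the centre is visible. -/
theorem agree_zero (h : IndexedAt o idx) (A B : Marked ι) : Agree o idx 0 A B := by
  rw [agree_iff h]
  have hz : ∀ (G : LFGraph) (u v : G.V), G.graph.dist u v ≤ 0 ↔ u = v := fun G u v => by
    rw [Nat.le_zero]; exact G.connected.dist_eq_zero_iff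
  refine ⟨fun _ => B.mark o, fun _ => A.mark o, ⟨rfl, ?_, ?_, ?_, ?_, ?_⟩, ?_⟩
  · intro v _; simp
  · intro v _; simp
  · intro v hv; exact (hz _ _ _).1 hv
  · intro v hv; exact (hz _ _ _).1 hv
  · intro u v hu hv
    rw [← (hz _ _ _).1 hu, ← (hz _ _ _).1 hv]
    simp
  · intro i hi v hv
    rw [(h.eq_zero_iff i).1 (Nat.le_zero.1 hi), ← (hz _ _ _).1 hv]
    simp

/-- The classes that agree with `p` up to radius `r`. -/
def basicSet (o : ι) (idx : ι → ℕ) (r : ℕ) (p : MarkedClass ι) : Set (MarkedClass ι) :=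
  {q | Agree o idx r p.rep q.rep}

theorem isOpen_iff_agree (h : IndexedAt o idx) (U : Set (MarkedClass ι)) :
    IsOpen[distTopology (locDist o idx)] U ↔
      ∀ p ∈ U, ∃ r, ∀ q, Agree o idx r p.rep q.rep → q ∈ U := by
  constructor
  · intro hU p hp
    obtain ⟨ε, hε, hU⟩ := hU p hp
    obtain ⟨r, hr⟩ := exists_nat_one_div_lt hε
    refine ⟨r, fun q hq => hU q (lt_of_le_of_lt ?_ hr)⟩
    refine csInf_le ⟨0, ?_⟩ ⟨r, hq, rfl⟩
    rintro t ⟨s, -, rfl⟩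
    positivity
  · intro hU p hp
    obtain ⟨r, hr⟩ := hU p hp
    refine ⟨1 / ((r : ℝ) + 1), by positivity, fun q hq => hr q ?_⟩
    obtain ⟨_, ⟨s, hs, rfl⟩, hlt⟩ := exists_lt_of_csInf_lt
      (s := {t : ℝ | ∃ r : ℕ, Agree o idx r p.rep q.rep ∧ t = 1 / ((r : ℝ) + 1)})
      ⟨_, 0, agree_zero h _ _, rfl⟩ hq
    refine hs.mono h ?_
    have := (one_div_lt_one_div (by positivity) (by positivity)).1 hlt
    exact_mod_cast (by linarith : (r : ℝ) ≤ s)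

theorem ball_finite (G : LFGraph) (x : G.V) (r : ℕ) : (G.ball x r).Finite := by
  induction r with
  | zero =>
    refine (Set.finite_singleton x).subset fun v hv => ?_
    exact (G.connected.dist_eq_zero_iff.1 (Nat.le_zero.1 hv)).symm
  | succ r ih =>
    refine (ih.union (ih.biUnion fun u _ => G.locallyFinite u)).subset fun v hv => ?_
    rcases Nat.lt_or_ge r (G.graph.dist x v) with h | h
    · obtain ⟨p, hp⟩ := G.connected.exists_walk_length_eq_dist v x
      have hv' : G.graph.dist x v ≤ r + 1 := hv
      rw [SimpleGraph.dist_comm] at hp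
      cases p with
      | nil => simp at h
      | @cons _ w _ e p =>
        refine Or.inr (Set.mem_biUnion (x := w) ?_ e.symm)
        change G.graph.dist x w ≤ r
        rw [SimpleGraph.dist_comm]
        have := SimpleGraph.dist_le p
        rw [SimpleGraph.Walk.length_cons] at hp
        omega
    · exact Or.inl h

/-- The part of a marked graph visible up to radius `r`, recorded by the labels of its vertices. -/
def localCode (o : ι) (idx : ι → ℕ) (r : ℕ) (A : Marked ι) :
    Set ℕ × Set (ℕ × ℕ) × Set (ι × ℕ) :=
  (Subtype.val '' A.G.ball (A.mark o) r,
    {e | ∃ u v : A.G.V, u ∈ A.G.ball (A.mark o) r ∧ v ∈ A.G.ball (A.mark o) r ∧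
      A.G.graph.Adj u v ∧ e = (u.1, v.1)},
    {m | idx m.1 ≤ r ∧ A.mark m.1 ∈ A.G.ball (A.mark o) r ∧ m.2 = (A.mark m.1).1})

theorem countable_range_localCode [Countable ι] (h : IndexedAt o idx) (r : ℕ) :
    (Set.range (localCode o idx r)).Countable := by
  refine ((Set.countable_ofPred_finite_subset (s := (Set.univ : Set ℕ)) (Set.to_countable _)).prod
    ((Set.countable_ofPred_finite_subset (s := (Set.univ : Set (ℕ × ℕ))) (Set.to_countable _)).prod
    (Set.countable_ofPred_finite_subset (s := (Set.univ : Set (ι × ℕ)))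
      (Set.to_countable _)))).mono ?_
  rintro _ ⟨A, rfl⟩
  have hb := ball_finite A.G (A.mark o) r
  refine ⟨⟨hb.image _, Set.subset_univ _⟩, ⟨?_, Set.subset_univ _⟩, ?_, Set.subset_univ _⟩
  · refine ((hb.image Subtype.val).prod (hb.image Subtype.val)).subset ?_
    rintro _ ⟨u, v, hu, hv, -, rfl⟩
    exact ⟨⟨u, hu, rfl⟩, ⟨v, hv, rfl⟩⟩
  · refine ((h.finite r).image fun i => (i, (A.mark i).1)).subset ?_
    rintro ⟨i, l⟩ ⟨hi, -, hl⟩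
    exact ⟨i, hi, Prod.ext rfl (Eq.symm hl)⟩

theorem agree_of_localCode_eq (h : IndexedAt o idx) {r : ℕ} {A B : Marked ι}
    (hAB : localCode o idx r A = localCode o idx r B) : Agree o idx r A B := by
  classical
  obtain ⟨hb, he, hm⟩ : _ ∧ _ ∧ _ := by simpa only [localCode, Prod.mk.injEq] using hAB
  -- the identity of the labels, in either direction
  have key : ∀ {A B : Marked ι}, Subtype.val '' A.G.ball (A.mark o) r =
      (Subtype.val '' B.G.ball (B.mark o) r : Set ℕ) →
      ∃ f : A.G.V → B.G.V, ∀ v, A.G.graph.dist (A.mark o) v ≤ r →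
        (f v).1 = v.1 ∧ B.G.graph.dist (B.mark o) (f v) ≤ r := by
    intro A B hb
    refine ⟨fun v => if hv : v.1 ∈ B.G.V then ⟨v.1, hv⟩ else B.mark o, fun v hv => ?_⟩
    obtain ⟨w, hw, hwv⟩ : v.1 ∈ (Subtype.val '' B.G.ball (B.mark o) r : Set ℕ) :=
      hb ▸ ⟨v, hv, rfl⟩
    have hvB : v.1 ∈ B.G.V := hwv ▸ w.2
    simp only [hvB, dif_pos, true_and]
    have : (⟨v.1, hvB⟩ : B.G.V) = w := Subtype.ext hwv.symm
    rw [this]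
    exact hw
  obtain ⟨f, hf⟩ := key hb
  obtain ⟨g, hg⟩ := key hb.symm
  have hmark : ∀ i, idx i ≤ r → A.G.graph.dist (A.mark o) (A.mark i) ≤ r →
      B.G.graph.dist (B.mark o) (B.mark i) ≤ r ∧ (A.mark i).1 = (B.mark i).1 := fun i hi hd => by
    have : (i, (A.mark i).1) ∈ {m : ι × ℕ | idx m.1 ≤ r ∧ B.mark m.1 ∈ B.G.ball (B.mark o) r ∧
      m.2 = (B.mark m.1).1} := hm ▸ ⟨hi, hd, rfl⟩
    exact this.2
  have hmark' : ∀ i, idx i ≤ r → B.G.graph.dist (B.mark o) (B.mark i) ≤ r →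
      A.G.graph.dist (A.mark o) (A.mark i) ≤ r ∧ (B.mark i).1 = (A.mark i).1 := fun i hi hd => by
    have : (i, (B.mark i).1) ∈ {m : ι × ℕ | idx m.1 ≤ r ∧ A.mark m.1 ∈ A.G.ball (A.mark o) r ∧
      m.2 = (A.mark m.1).1} := hm ▸ ⟨hi, hd, rfl⟩
    exact this.2
  rw [agree_iff h]
  refine ⟨f, g, ⟨?_, fun v hv => (hf v hv).2, fun w hw => (hg w hw).2, fun v hv => ?_,
    fun w hw => ?_, fun u v hu hv => ?_⟩, fun i hi v hv => ⟨?_, fun hv' => ?_⟩⟩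
  · refine Subtype.ext ?_
    rw [(hf _ (by simp)).1]
    exact (hmark o (h.le r) (by simp)).2
  · exact Subtype.ext ((hg _ (hf v hv).2).1.trans (hf v hv).1)
  · exact Subtype.ext ((hf _ (hg w hw).2).1.trans (hg w hw).1)
  · constructor
    · intro e
      have : ((f u).1, (f v).1) ∈ {e : ℕ × ℕ | ∃ u v : A.G.V, u ∈ A.G.ball (A.mark o) r ∧
          v ∈ A.G.ball (A.mark o) r ∧ A.G.graph.Adj u v ∧ e = (u.1, v.1)} :=
        he ▸ ⟨f u, f v, (hf u hu).2, (hf v hv).2, e, rfl⟩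
      obtain ⟨u', v', -, -, e', h'⟩ := this
      rw [(hf u hu).1, (hf v hv).1, Prod.mk.injEq] at h'
      rwa [Subtype.ext h'.1, Subtype.ext h'.2]
    · intro e
      have : (u.1, v.1) ∈ {e : ℕ × ℕ | ∃ u v : B.G.V, u ∈ B.G.ball (B.mark o) r ∧
          v ∈ B.G.ball (B.mark o) r ∧ B.G.graph.Adj u v ∧ e = (u.1, v.1)} :=
        he ▸ ⟨u, v, hu, hv, e, rfl⟩
      obtain ⟨u', v', -, -, e', h'⟩ := this
      rw [← (hf u hu).1, ← (hf v hv).1, Prod.mk.injEq] at h'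
      rwa [Subtype.ext h'.1, Subtype.ext h'.2]
  · rintro rfl
    exact Subtype.ext ((hf _ hv).1.trans (hmark i hi hv).2)
  · refine Subtype.ext ?_
    rw [← (hf v hv).1, hv']
    exact (hmark' i hi (hv' ▸ (hf v hv).2)).2

/-- Agreement up to radius `r` has countably many classes. -/
theorem exists_countable_agree [Countable ι] (h : IndexedAt o idx) (r : ℕ) :
    ∃ S : Set (MarkedClass ι), S.Countable ∧ ∀ p : MarkedClass ι, ∃ q ∈ S,
      Agree o idx r q.rep p.rep := by
  have hc : (Set.range fun p : MarkedClass ι => localCode o idx r p.rep).Countable :=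
    (countable_range_localCode h r).mono (by rintro _ ⟨p, rfl⟩; exact ⟨p.rep, rfl⟩)
  choose s hs using fun c : Set.range fun p : MarkedClass ι => localCode o idx r p.rep => c.2
  have := hc.to_subtype
  refine ⟨Set.range s, Set.countable_range s, fun p => ⟨s ⟨_, p, rfl⟩, ⟨_, rfl⟩, ?_⟩⟩
  exact agree_of_localCode_eq h (hs ⟨_, p, rfl⟩)

/-- The Borel σ-algebra of the local distance is generated by the basic sets. -/
theorem borel_eq_generateFrom_basicSet [Countable ι] (h : IndexedAt o idx) :
    @borel (MarkedClass ι) (distTopology (locDist o idx)) =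
      MeasurableSpace.generateFrom {s | ∃ r p, s = basicSet o idx r p} := by
  refine le_antisymm (MeasurableSpace.generateFrom_le fun U hU => ?_)
    (MeasurableSpace.generateFrom_le ?_)
  · have hU' := (isOpen_iff_agree h U).1 hU
    choose S hSc hS using fun r => exists_countable_agree (ι := ι) h r
    have hUeq : U = ⋃ r, ⋃ q ∈ {q ∈ S r | basicSet o idx r q ⊆ U}, basicSet o idx r q := by
      refine Set.Subset.antisymm (fun p hp => ?_)
        (Set.iUnion_subset fun r => Set.iUnion₂_subset fun q hq => hq.2)
      obtain ⟨r, hr⟩ := hU' p hp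
      obtain ⟨q, hq, hqp⟩ := hS r p
      refine Set.mem_iUnion.2 ⟨r, Set.mem_iUnion₂.2 ⟨q, ⟨hq, fun q' hq' => ?_⟩, hqp⟩⟩
      exact hr q' ((hqp.symm h).trans h hq')
    rw [hUeq]
    exact MeasurableSet.iUnion fun r => MeasurableSet.biUnion ((hSc r).mono fun q hq => hq.1)
      fun q _ => MeasurableSpace.measurableSet_generateFrom ⟨r, q, rfl⟩
  · rintro _ ⟨r, p, rfl⟩
    refine MeasurableSpace.measurableSet_generateFrom ?_
    refine (isOpen_iff_agree h _).2 fun q hq => ⟨r, fun q' hq' => ?_⟩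
    exact Agree.trans h hq hq'

theorem isPiSystem_basicSet (h : IndexedAt o idx) :
    IsPiSystem {s : Set (MarkedClass ι) | ∃ r p, s = basicSet o idx r p} := by
  have key : ∀ {r r' : ℕ} {p p' : MarkedClass ι}, r ≤ r' →
      (basicSet o idx r p ∩ basicSet o idx r' p').Nonempty →
      basicSet o idx r p ∩ basicSet o idx r' p' = basicSet o idx r' p' := by
    rintro r r' p p' hr ⟨q, hq, hq'⟩
    refine Set.inter_eq_right.2 fun q'' hq'' => ?_
    exact Agree.trans h hq (Agree.mono h hr (((Agree.symm h hq').trans h hq'')))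
  rintro _ ⟨r, p, rfl⟩ _ ⟨r', p', rfl⟩ hne
  rcases le_total r r' with hr | hr
  · exact ⟨r', p', key hr hne⟩
  · rw [Set.inter_comm] at hne ⊢
    exact ⟨r, p, key hr hne⟩

/-- Change of the distinguished vertices along a map of the index types. -/
def MarkedClass.reindex (σ : κ → ι) : MarkedClass ι → MarkedClass κ :=
  Quotient.map (fun A => ⟨A.G, fun i => A.mark (σ i)⟩) fun _ _ ⟨φ, hφ⟩ => ⟨φ, fun i => hφ (σ i)⟩

theorem reindex_cls (σ : κ → ι) (A : Marked ι) :
    A.cls.reindex σ = (Marked.mk A.G fun i => A.mark (σ i)).cls := rfl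

theorem Agree.exists_reindex (h : IndexedAt o idx) (h' : IndexedAt o' idx') (σ : κ → ι)
    (A : Marked ι) (r : ℕ) : ∃ R, ∀ B : Marked ι, Agree o idx R A B →
      Agree o' idx' r (Marked.mk A.G fun i => A.mark (σ i))
        (Marked.mk B.G fun i => B.mark (σ i)) := by
  obtain ⟨b, hb⟩ := ((h'.finite r).image fun i => idx (σ i)).bddAbove
  have hb' : ∀ i, idx' i ≤ r → idx (σ i) ≤ b := fun i hi => hb ⟨i, hi, rfl⟩
  set u := A.mark (σ o') with hu
  refine ⟨b + A.G.graph.dist (A.mark o) u + r, fun B hAB => ?_⟩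
  rw [agree_iff h] at hAB
  rw [agree_iff h']
  obtain ⟨f, g, hL, hm⟩ := hAB
  have hfu : f u = B.mark (σ o') :=
    (hm (σ o') ((hb' o' (h'.le r)).trans (by omega)) u (by omega)).1 rfl
  refine ⟨f, g, ?_, fun i hi v hv => ?_⟩
  · have := hL.restrict (u := u) (r := r) (by omega)
    rwa [hfu] at this
  · refine hm (σ i) ((hb' i hi).trans (by omega)) v ?_
    have h1 := A.G.connected.dist_triangle (u := A.mark o) (v := u) (w := v)
    change A.G.graph.dist u v ≤ r at hv
    omega

theorem continuous_reindex (h : IndexedAt o idx) (h' : IndexedAt o' idx') (σ : κ → ι) :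
    @Continuous _ _ (distTopology (locDist o idx)) (distTopology (locDist o' idx'))
      (MarkedClass.reindex σ) := by
  refine @Continuous.mk _ _ (_) (_) _ fun U hU => ?_
  rw [isOpen_iff_agree h'] at hU
  rw [isOpen_iff_agree h]
  intro p hp
  obtain ⟨r, hr⟩ := hU _ hp
  obtain ⟨R, hR⟩ := Agree.exists_reindex h h' σ p.rep r
  refine ⟨R, fun q hq => hr _ ?_⟩
  have := hR q.rep hq
  rw [← agree_rep_iff h', ← reindex_cls σ p.rep, ← reindex_cls σ q.rep, cls_rep, cls_rep] at this
  exact this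

end Marked

theorem indexedAt_rooted : IndexedAt (() : Unit) (fun _ => 0) :=
  ⟨fun _ => iff_of_true rfl rfl, fun _ => Set.toFinite _⟩

theorem indexedAt_biRooted : IndexedAt (0 : Fin 2) Fin.val :=
  ⟨by decide, fun _ => Set.toFinite _⟩

theorem indexedAt_path : IndexedAt (0 : ℕ) id :=
  ⟨fun _ => Iff.rfl, fun r => Set.finite_Iic r⟩

instance : BorelSpace Rooted := ⟨rfl⟩
instance : BorelSpace BiRooted := ⟨rfl⟩
instance : BorelSpace PathSpace := ⟨rfl⟩

/-! ### Measurable dependence of the walk on the graph -/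

/-- The class of `(G, v)`. -/
def rootClass (G : LFGraph) (v : G.V) : Rooted := (Marked.mk G fun _ => v).cls

/-- The class of `(G, u, v)`. -/
def pairClass (G : LFGraph) (u v : G.V) : BiRooted := (Marked.mk G ![u, v]).cls

/-- The class of `(G, (xₙ))`. -/
def pathClass (G : LFGraph) (x : ℕ → G.V) : PathSpace := (Marked.mk G x).cls

theorem rootClass_rep (g : Rooted) : rootClass g.rep.G (g.rep.mark ()) = g := cls_rep g

theorem pathClass_rep (q : PathSpace) : pathClass q.rep.G q.rep.mark = q := cls_rep q

theorem pairClass_rep (b : BiRooted) : pairClass b.rep.G (b.rep.mark 0) (b.rep.mark 1) = b := by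
  conv_rhs => rw [← cls_rep b]
  unfold pairClass
  congr 2
  funext i
  fin_cases i <;> rfl

theorem exists_iso_cls_rep {ι : Type} (A : Marked ι) :
    ∃ φ : A.G.graph ≃g A.cls.rep.G.graph, ∀ i, φ (A.mark i) = A.cls.rep.mark i :=
  cls_eq_iff.1 (cls_rep A.cls).symm

theorem exists_iso_rep_pathClass (G : LFGraph) (x : ℕ → G.V) :
    ∃ φ : G.graph ≃g (pathClass G x).rep.G.graph, ∀ i, φ (x i) = (pathClass G x).rep.mark i :=
  exists_iso_cls_rep (Marked.mk G x)

theorem exists_iso_rep_rootClass (G : LFGraph) (v : G.V) :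
    ∃ φ : G.graph ≃g (rootClass G v).rep.G.graph, φ v = (rootClass G v).rep.mark () := by
  obtain ⟨φ, hφ⟩ := exists_iso_cls_rep (Marked.mk G fun _ : Unit => v)
  exact ⟨φ, hφ ()⟩

theorem exists_iso_rep_pairClass (G : LFGraph) (u v : G.V) :
    ∃ φ : G.graph ≃g (pairClass G u v).rep.G.graph, φ u = (pairClass G u v).rep.mark 0 ∧
      φ v = (pairClass G u v).rep.mark 1 := by
  obtain ⟨φ, hφ⟩ := exists_iso_cls_rep (Marked.mk G ![u, v])
  exact ⟨φ, hφ 0, hφ 1⟩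

theorem pathClass_iso {G H : LFGraph} (φ : G.graph ≃g H.graph) (x : ℕ → G.V) :
    pathClass H (fun i => φ (x i)) = pathClass G x :=
  (cls_eq_iff.2 ⟨φ, fun _ => rfl⟩).symm

theorem reindex_pathClass (σ : ℕ → ℕ) (G : LFGraph) (x : ℕ → G.V) :
    (pathClass G x).reindex σ = pathClass G fun i => x (σ i) := rfl

theorem rootAt_eq (n : ℕ) : rootAt n = MarkedClass.reindex fun _ => n := by
  funext q
  conv_rhs => rw [← cls_rep q]
  rfl

theorem shift_eq : shift = MarkedClass.reindex fun n => n + 1 := by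
  funext q
  conv_rhs => rw [← cls_rep q]
  rfl

theorem biRootAt_eq (m n : ℕ) : biRootAt m n = MarkedClass.reindex ![m, n] := by
  funext q
  conv_rhs => rw [← cls_rep q]
  rw [reindex_cls, biRootAt]
  congr 2
  funext i
  fin_cases i <;> rfl

theorem rootAt_pathClass (n : ℕ) (G : LFGraph) (x : ℕ → G.V) :
    rootAt n (pathClass G x) = rootClass G (x n) := by
  rw [rootAt_eq]; rfl

theorem shift_pathClass (G : LFGraph) (x : ℕ → G.V) :
    shift (pathClass G x) = pathClass G fun n => x (n + 1) := by
  rw [shift_eq]; rfl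

theorem biRootAt_pathClass (m n : ℕ) (G : LFGraph) (x : ℕ → G.V) :
    biRootAt m n (pathClass G x) = pairClass G (x m) (x n) := by
  rw [biRootAt_eq, pathClass, reindex_cls, pairClass]
  congr 2
  funext i
  fin_cases i <;> rfl

theorem distAt_pathClass (n : ℕ) (G : LFGraph) (x : ℕ → G.V) :
    distAt n (pathClass G x) = G.graph.dist (x 0) (x n) := by
  obtain ⟨φ, hφ⟩ := exists_iso_rep_pathClass G x
  rw [distAt, ← hφ, ← hφ, dist_iso]

theorem measurable_reindex_path (σ : ℕ → ℕ) :
    Measurable (MarkedClass.reindex σ : PathSpace → PathSpace) :=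
  (continuous_reindex indexedAt_path indexedAt_path σ).measurable

theorem measurable_rootAt (n : ℕ) : Measurable (rootAt n) := by
  rw [rootAt_eq]
  exact (continuous_reindex indexedAt_path indexedAt_rooted _).measurable

theorem measurable_shift : Measurable shift := by
  rw [shift_eq]
  exact measurable_reindex_path _

theorem measurable_biRootAt (m n : ℕ) : Measurable (biRootAt m n) := by
  rw [biRootAt_eq]
  exact (continuous_reindex indexedAt_path indexedAt_biRooted _).measurable

theorem measurable_of_locallyConstant {β : Type*} [MeasurableSpace β] {F : PathSpace → β}
    (hF : ∀ p, ∃ r, ∀ q, Agree 0 id r p.rep q.rep → F q = F p) : Measurable F := by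
  intro s _
  refine IsOpen.measurableSet ((isOpen_iff_agree indexedAt_path _).2 fun p hp => ?_)
  obtain ⟨r, hr⟩ := hF p
  exact ⟨r, fun q hq => by
    change F q ∈ s
    rw [hr q hq]
    exact hp⟩

theorem measurable_distAt (n : ℕ) : Measurable (distAt n) := by
  refine measurable_of_locallyConstant fun p => ⟨n + distAt n p, fun q hq => ?_⟩
  obtain ⟨f, g, hL, hm⟩ := (agree_iff indexedAt_path).1 hq
  have h0 : p.rep.G.graph.dist (p.rep.mark 0) (p.rep.mark n) ≤ n + distAt n p := by
    rw [distAt]; omega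
  have h1 : f (p.rep.mark n) = q.rep.mark n :=
    (hm n (by simp) _ h0).1 rfl
  have := hL.dist_map (u := p.rep.mark 0) (v := p.rep.mark n) (by simpa using h0)
  rwa [hL.map_root, h1] at this

theorem agree_of_marks_eq {ι : Type} {o : ι} {idx : ι → ℕ} (h : IndexedAt o idx) {r : ℕ}
    (G : LFGraph) {x x' : ι → G.V} (hx : ∀ i, idx i ≤ r → x i = x' i) :
    Agree o idx r (Marked.mk G x) (Marked.mk G x') := by
  rw [agree_iff h]
  have ho : x o = x' o := hx o (h.le r)
  refine ⟨id, id, ⟨ho, fun v hv => ?_, fun v hv => ?_, fun _ _ => rfl, fun _ _ => rfl,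
    fun _ _ _ _ => Iff.rfl⟩, fun i hi v _ => ?_⟩
  · change G.graph.dist (x o) v ≤ r at hv
    rw [ho] at hv; exact hv
  · change G.graph.dist (x' o) v ≤ r at hv
    rw [← ho] at hv; exact hv
  · change v = x i ↔ v = x' i
    rw [hx i hi]

theorem measurableSpace_path_eq : instMeasurableSpacePathSpace =
    MeasurableSpace.generateFrom {s | ∃ r p, s = basicSet (0 : ℕ) id r p} :=
  borel_eq_generateFrom_basicSet indexedAt_path

theorem measurableSet_basicSet (r : ℕ) (p : PathSpace) :
    MeasurableSet (basicSet (0 : ℕ) id r p) := by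
  rw [measurableSpace_path_eq]
  exact MeasurableSpace.measurableSet_generateFrom ⟨r, p, rfl⟩

theorem pathClass_mem_basicSet {r : ℕ} {p : PathSpace} {G : LFGraph} {x : ℕ → G.V} :
    pathClass G x ∈ basicSet (0 : ℕ) id r p ↔ Agree 0 id r p.rep (Marked.mk G x) := by
  have h := agree_rep_iff indexedAt_path (r := r) (A := p.rep) (B := Marked.mk G x)
  rw [cls_rep] at h
  exact h

/-- Membership in a basic set of radius `r` only depends on the marks up to index `r`. -/
theorem pathClass_mem_basicSet_congr {r : ℕ} {p : PathSpace} {G : LFGraph} {x x' : ℕ → G.V}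
    (h : ∀ i ≤ r, x i = x' i) :
    pathClass G x ∈ basicSet (0 : ℕ) id r p ↔ pathClass G x' ∈ basicSet (0 : ℕ) id r p := by
  rw [pathClass_mem_basicSet, pathClass_mem_basicSet]
  have := agree_of_marks_eq indexedAt_path (r := r) G h
  exact ⟨fun h' => h'.trans indexedAt_path this,
    fun h' => h'.trans indexedAt_path (this.symm indexedAt_path)⟩

theorem measurable_pathClass (G : LFGraph) : Measurable (pathClass G) := by
  rw [measurableSpace_path_eq]
  refine measurable_generateFrom ?_
  rintro _ ⟨r, p, rfl⟩
  have : pathClass G ⁻¹' basicSet (0 : ℕ) id r p =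
      initSeg r ⁻¹' (initSeg r '' (pathClass G ⁻¹' basicSet (0 : ℕ) id r p)) := by
    refine Set.Subset.antisymm (Set.subset_preimage_image _ _) ?_
    rintro x ⟨x', hx', hxx'⟩
    refine (pathClass_mem_basicSet_congr fun i hi => ?_).1 hx'
    exact congrFun hxx' ⟨i, Nat.lt_succ_of_le hi⟩
  rw [this]
  exact measurable_initSeg r (Set.to_countable _).measurableSet

/-- A map into measures on path space is measurable as soon as its values on basic sets are. -/
theorem measurable_measure_of_basicSet {α : Type*} [MeasurableSpace α] {μ : α → Measure PathSpace}
    [∀ a, IsProbabilityMeasure (μ a)]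
    (h : ∀ r p, Measurable fun a => μ a (basicSet (0 : ℕ) id r p)) : Measurable μ := by
  refine Measurable.measure_of_isPiSystem_of_isProbabilityMeasure measurableSpace_path_eq
    (isPiSystem_basicSet indexedAt_path) ?_
  rintro _ ⟨r, p, rfl⟩
  exact h r p

section Prepend

/-- The law of `(G, Y, x₀, x₁, …)`, where `Y` is a step of simple random walk from `x₀`. -/
noncomputable def prependLaw (q : PathSpace) : Measure PathSpace :=
  (q.rep.G.step (q.rep.mark 0)).toMeasure.map fun y => pathClass q.rep.G (consSeq y q.rep.mark)

instance (q : PathSpace) : IsProbabilityMeasure (prependLaw q) :=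
  Measure.isProbabilityMeasure_map (measurable_of_countable _).aemeasurable

/-- The average of `F (G, Y, x₀, x₁, …)` over a step `Y` of simple random walk from `x₀`. -/
noncomputable def prependAvg (F : PathSpace → ENNReal) (q : PathSpace) : ENNReal :=
  ∫⁻ p, F p ∂(prependLaw q)

theorem prependAvg_pathClass {F : PathSpace → ENNReal} (hF : Measurable F) (G : LFGraph)
    (x : ℕ → G.V) :
    prependAvg F (pathClass G x) = ∑' y, G.step (x 0) y * F (pathClass G (consSeq y x)) := by
  obtain ⟨φ, hφ⟩ := exists_iso_rep_pathClass G x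
  rw [prependAvg, prependLaw, lintegral_map hF (measurable_of_countable _), LFGraph.lintegral_step,
    ← hφ, LFGraph.tsum_step_iso φ]
  refine tsum_congr fun y => ?_
  rw [← pathClass_iso φ (consSeq y x)]
  congr 3
  funext i
  cases i with
  | zero => rfl
  | succ i => exact (hφ i).symm

theorem LocIso.step_eq {G H : LFGraph} {x : G.V} {y : H.V} {f : G.V → H.V} {g : H.V → G.V}
    (h : LocIso G H x y 1 f g) {v : G.V} (hv : G.graph.dist x v ≤ 1) :
    H.step y (f v) = G.step x v := by
  classical
  have hadj : ∀ {G : LFGraph} {x v : G.V}, G.graph.Adj x v → G.graph.dist x v ≤ 1 :=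
    fun e => (SimpleGraph.dist_eq_one_iff_adj.2 e).le
  have hx : G.graph.dist x x ≤ 1 := by simp
  have hadj_iff : ∀ v, G.graph.dist x v ≤ 1 → (H.graph.Adj y (f v) ↔ G.graph.Adj x v) :=
    fun v hv => by rw [← h.adj x v hx hv, h.map_root]
  have hdeg : H.deg y = G.deg x := by
    unfold LFGraph.deg
    refine (Finset.card_bij (fun v _ => f v) (fun v hv => ?_) (fun v hv w hw hvw => ?_)
      (fun w hw => ⟨g w, ?_, ?_⟩)).symm
    · rw [LFGraph.mem_nbrs] at hv ⊢
      exact (hadj_iff v (hadj hv)).2 hv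
    · rw [LFGraph.mem_nbrs] at hv hw
      rw [← h.left_inv v (hadj hv), ← h.left_inv w (hadj hw), hvw]
    · rw [LFGraph.mem_nbrs] at hw ⊢
      rw [← hadj_iff _ (h.maps_inv w (hadj hw)), h.right_inv w (hadj hw)]
      exact hw
    · rw [LFGraph.mem_nbrs] at hw
      exact h.right_inv w (hadj hw)
  rw [LFGraph.step_apply, LFGraph.step_apply, hdeg]
  refine if_congr (or_congr (hadj_iff v hv) (and_congr ⟨fun e => ?_, fun e => ?_⟩
    ⟨fun e w hw => ?_, fun e w hw => ?_⟩)) rfl rfl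
  · rw [← h.left_inv x hx, h.map_root, e, h.left_inv v hv]
  · rw [← e, h.map_root]
  · exact e (f w) ((hadj_iff w (hadj hw)).2 hw)
  · refine e (g w) ((hadj_iff _ (h.maps_inv w (hadj hw))).1 ?_)
    rwa [h.right_inv w (hadj hw)]

theorem dist_le_one_of_step_ne_zero {G : LFGraph} {u v : G.V} (h : G.step u v ≠ 0) :
    G.graph.dist u v ≤ 1 := by
  rcases G.step_ne_zero_iff.1 h with h | h
  · exact (SimpleGraph.dist_eq_one_iff_adj.2 h).le
  · rw [h.1]; simp

theorem tsum_eq_of_locIso {G H : LFGraph} {x : G.V} {y : H.V} {r : ℕ} {f : G.V → H.V}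
    {g : H.V → G.V} (h : LocIso G H x y r f g) {a : G.V → ENNReal} {b : H.V → ENNReal}
    (ha : ∀ v, a v ≠ 0 → G.graph.dist x v ≤ r) (hb : ∀ w, b w ≠ 0 → H.graph.dist y w ≤ r)
    (hab : ∀ v, G.graph.dist x v ≤ r → a v = b (f v)) : ∑' v, a v = ∑' w, b w := by
  refine (tsum_eq_tsum_of_ne_zero_bij (fun v : Function.support a => f v.1) ?_ ?_ ?_).symm
  · rintro ⟨v, hv⟩ ⟨w, hw⟩ hvw
    refine Subtype.ext ?_
    change v = w
    rw [← h.left_inv v (ha v hv), ← h.left_inv w (ha w hw)]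
    exact congrArg g hvw
  · intro w hw
    have hw' := hb w hw
    refine ⟨⟨g w, ?_⟩, h.right_inv w hw'⟩
    rw [Function.mem_support, hab _ (h.maps_inv w hw'), h.right_inv w hw']
    exact hw
  · rintro ⟨v, hv⟩
    exact (hab v (ha v hv)).symm

/-- Isomorphic balls of radius `r + 1` have corresponding steps from the root, after which the balls
of radius `r` still correspond; so `prependLaw` is locally constant on basic sets. -/
theorem measurable_prependLaw : Measurable prependLaw := by
  refine measurable_measure_of_basicSet fun r p₀ => measurable_of_locallyConstant fun p =>
    ⟨r + 1, fun q hpq => ?_⟩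
  obtain ⟨f, g, hL, hm⟩ := (agree_iff indexedAt_path).1 hpq
  have hset := measurableSet_basicSet r p₀
  have hF : Measurable ((basicSet (0 : ℕ) id r p₀).indicator (1 : PathSpace → ENNReal)) :=
    measurable_one.indicator hset
  rw [← lintegral_indicator_one hset, ← lintegral_indicator_one hset]
  change prependAvg _ q = prependAvg _ p
  rw [← pathClass_rep q, ← pathClass_rep p, prependAvg_pathClass hF, prependAvg_pathClass hF]
  refine (tsum_eq_of_locIso (hL.mono (r := 1) (by omega))
    (fun v hv => dist_le_one_of_step_ne_zero (left_ne_zero_of_mul hv))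
    (fun v hv => dist_le_one_of_step_ne_zero (left_ne_zero_of_mul hv)) fun v hv => ?_).symm
  rw [(hL.mono (r := 1) (by omega)).step_eq hv]
  congr 1
  have hag : Agree 0 id r (Marked.mk p.rep.G (consSeq v p.rep.mark))
      (Marked.mk q.rep.G (consSeq (f v) q.rep.mark)) := by
    rw [agree_iff indexedAt_path]
    refine ⟨f, g, hL.restrict (u := v) (r := r) (by omega), fun i hi w hw => ?_⟩
    have hw' : p.rep.G.graph.dist v w ≤ r := hw
    have htri := p.rep.G.connected.dist_triangle (u := p.rep.mark 0) (v := v) (w := w)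
    cases i with
    | zero =>
      refine ⟨fun e => by rw [e]; rfl, fun e => ?_⟩
      change w = v
      rw [← hL.left_inv w (by omega), ← hL.left_inv v (by omega)]
      exact congrArg g e
    | succ i => exact hm i (by simp only [id_eq] at hi ⊢; omega) w (by omega)
  refine Set.indicator_eq_indicator ?_ rfl
  rw [pathClass_mem_basicSet, pathClass_mem_basicSet]
  exact ⟨fun h' => h'.trans indexedAt_path hag,
    fun h' => h'.trans indexedAt_path (hag.symm indexedAt_path)⟩

theorem measurable_prependAvg {F : PathSpace → ENNReal} (hF : Measurable F) :
    Measurable (prependAvg F) :=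
  (Measure.measurable_lintegral hF).comp measurable_prependLaw

theorem measurable_prependAvg_iterate {F : PathSpace → ENNReal} (hF : Measurable F) (n : ℕ) :
    Measurable (prependAvg^[n] F) := by
  induction n with
  | zero => exact hF
  | succ n ih =>
    rw [Function.iterate_succ_apply']
    exact measurable_prependAvg ih

/-- The sequence `zₙ, …, z₁, w₀, w₁, …`. -/
def revPrefix {α : Type*} (n : ℕ) (z w : ℕ → α) (i : ℕ) : α :=
  if i < n then z (n - i) else w (i - n)

theorem measurable_revPrefix {α : Type*} [MeasurableSpace α] (n : ℕ) (w : ℕ → α) :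
    Measurable fun z => revPrefix n z w := by
  refine measurable_pi_iff.2 fun i => ?_
  unfold revPrefix
  split_ifs
  · exact measurable_pi_apply _
  · exact measurable_const

/-- Iterating the one-step average puts the time-reversed walk from `w₀` in front of `w`. -/
theorem prependAvg_iterate_pathClass {F : PathSpace → ENNReal} (hF : Measurable F) (n : ℕ)
    (G : LFGraph) (w : ℕ → G.V) :
    prependAvg^[n] F (pathClass G w) =
      ∫⁻ z, F (pathClass G (revPrefix n z w)) ∂(G.srw (w 0)) := by
  induction n generalizing w with
  | zero =>
    have : ∀ z, revPrefix 0 z w = w := fun z => by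
      funext i
      simp [revPrefix]
    simp [this]
  | succ n ih =>
    rw [Function.iterate_succ_apply', prependAvg_pathClass (measurable_prependAvg_iterate hF n),
      G.lintegral_srw_first_step (w 0) (f := fun z => F (pathClass G (revPrefix (n + 1) z w)))
        ((hF.comp (measurable_pathClass G)).comp (measurable_revPrefix (n + 1) w))]
    refine tsum_congr fun y => ?_
    rw [ih, consSeq_zero]
    congr 1
    refine lintegral_congr_ae ?_
    filter_upwards [G.srw_ae_zero y] with z hz
    congr 2
    funext i
    unfold revPrefix
    rcases lt_trichotomy i n with h | rfl | h
    · rw [if_pos h, if_pos (by omega), show n + 1 - i = (n - i) + 1 by omega, consSeq_succ]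
    · rw [if_neg (lt_irrefl _), if_pos (by omega), show i + 1 - i = 0 + 1 by omega, consSeq_succ,
        Nat.sub_self, consSeq_zero, hz]
    · rw [if_neg (by omega), if_neg (by omega), show i - n = (i - (n + 1)) + 1 by omega,
        consSeq_succ]

end Prepend

instance (g : Rooted) : IsProbabilityMeasure (walkLawFrom g) :=
  Measure.isProbabilityMeasure_map (measurable_pathClass _).aemeasurable

theorem lintegral_walkLawFrom {F : PathSpace → ENNReal} (hF : Measurable F) (G : LFGraph)
    (v : G.V) :
    ∫⁻ q, F q ∂(walkLawFrom (rootClass G v)) = ∫⁻ z, F (pathClass G z) ∂(G.srw v) := by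
  obtain ⟨φ, hφ⟩ := exists_iso_rep_rootClass G v
  change ∫⁻ q, F q ∂((LFGraph.srw _ _).map (pathClass _)) = _
  rw [lintegral_map hF (measurable_pathClass _), ← hφ,
    LFGraph.lintegral_srw_iso φ v (f := fun z => F (pathClass _ z))
      (hF.comp (measurable_pathClass _))]
  simp only [pathClass_iso]

/-- The law of `(G, x, Z₀, Z₁, …)`, where `Z` is simple random walk started at the second root. -/
noncomputable def pairWalkLaw (b : BiRooted) : Measure PathSpace :=
  (b.rep.G.srw (b.rep.mark 1)).map fun z => pathClass b.rep.G (consSeq (b.rep.mark 0) z)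

instance (b : BiRooted) : IsProbabilityMeasure (pairWalkLaw b) :=
  Measure.isProbabilityMeasure_map
    ((measurable_pathClass _).comp (measurable_consSeq _)).aemeasurable

theorem lintegral_pairWalkLaw {F : PathSpace → ENNReal} (hF : Measurable F) (G : LFGraph)
    (u v : G.V) :
    ∫⁻ q, F q ∂(pairWalkLaw (pairClass G u v)) =
      ∫⁻ z, F (pathClass G (consSeq u z)) ∂(G.srw v) := by
  obtain ⟨φ, hφ, hφ'⟩ := exists_iso_rep_pairClass G u v
  rw [pairWalkLaw, lintegral_map (g := fun z => pathClass _ (consSeq _ z)) hF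
      ((measurable_pathClass _).comp (measurable_consSeq _)),
    ← hφ', LFGraph.lintegral_srw_iso φ v (f := fun z => F (pathClass _ (consSeq _ z)))
      (hF.comp ((measurable_pathClass _).comp (measurable_consSeq _))), ← hφ]
  refine lintegral_congr fun z => ?_
  rw [← pathClass_iso φ (consSeq u z)]
  congr 2
  funext i
  cases i <;> rfl

/-- On a basic set of radius `r` only the first `r` steps of the walk matter, and these are obtained
by iterating `prependAvg` and reversing the order of the marks. -/
theorem measurable_walkLawFrom : Measurable walkLawFrom := by
  refine measurable_measure_of_basicSet fun r p => ?_
  have hset := measurableSet_basicSet r p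
  have hF : Measurable ((basicSet (0 : ℕ) id r p).indicator (1 : PathSpace → ENNReal)) :=
    measurable_one.indicator hset
  have hF' := hF.comp (measurable_reindex_path fun i => r - i)
  have hemb : Measurable (MarkedClass.reindex (fun _ : ℕ => ()) : Rooted → PathSpace) :=
    (continuous_reindex indexedAt_rooted indexedAt_path _).measurable
  have key : (fun g => walkLawFrom g (basicSet (0 : ℕ) id r p)) = fun g =>
      prependAvg^[r] ((basicSet (0 : ℕ) id r p).indicator 1 ∘ MarkedClass.reindex fun i => r - i)
        (g.reindex fun _ => ()) := by
    funext g
    rw [← rootClass_rep g, ← lintegral_indicator_one hset, lintegral_walkLawFrom hF]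
    change _ = prependAvg^[r] _ (pathClass g.rep.G fun _ => g.rep.mark ())
    rw [prependAvg_iterate_pathClass hF']
    refine lintegral_congr_ae ?_
    filter_upwards [g.rep.G.srw_ae_zero (g.rep.mark ())] with z hz
    rw [Function.comp, reindex_pathClass]
    refine Set.indicator_eq_indicator (pathClass_mem_basicSet_congr fun i hi => ?_) rfl
    unfold revPrefix
    rcases Nat.eq_zero_or_pos i with rfl | h
    · simp [hz]
    · rw [if_pos (by omega), show r - (r - i) = i by omega]
  rw [key]
  exact (measurable_prependAvg_iterate hF' r).comp hemb

theorem measurable_pairWalkLaw : Measurable pairWalkLaw := by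
  refine measurable_measure_of_basicSet fun r p => ?_
  have hset := measurableSet_basicSet r p
  have hF : Measurable ((basicSet (0 : ℕ) id r p).indicator (1 : PathSpace → ENNReal)) :=
    measurable_one.indicator hset
  have hF' := hF.comp (measurable_reindex_path fun i => r + 1 - i)
  have hemb : Measurable (MarkedClass.reindex (fun i : ℕ => if i = 0 then (1 : Fin 2) else 0) :
      BiRooted → PathSpace) :=
    (continuous_reindex indexedAt_biRooted indexedAt_path _).measurable
  have key : (fun b => pairWalkLaw b (basicSet (0 : ℕ) id r p)) = fun b =>
      prependAvg^[r]
        ((basicSet (0 : ℕ) id r p).indicator 1 ∘ MarkedClass.reindex fun i => r + 1 - i)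
        (b.reindex fun i : ℕ => if i = 0 then (1 : Fin 2) else 0) := by
    funext b
    rw [← pairClass_rep b, ← lintegral_indicator_one hset, lintegral_pairWalkLaw hF]
    change _ = prependAvg^[r] _ (pathClass b.rep.G fun i =>
      ![b.rep.mark 0, b.rep.mark 1] (if i = 0 then 1 else 0))
    rw [prependAvg_iterate_pathClass hF']
    refine lintegral_congr_ae ?_
    filter_upwards [b.rep.G.srw_ae_zero (b.rep.mark 1)] with z hz
    rw [Function.comp, reindex_pathClass]
    refine Set.indicator_eq_indicator (pathClass_mem_basicSet_congr fun i hi => ?_) rfl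
    unfold revPrefix
    rcases i with _ | _ | i
    · simp
    · simp [hz]
    · rw [if_pos (by omega), show r - (r + 1 - (i + 1 + 1)) = i + 1 by omega, consSeq_succ]
  rw [key]
  exact (measurable_prependAvg_iterate hF' r).comp hemb

/-! ### Stationary walks and time reversal -/

section WalkLaw

variable (P : Measure Rooted)

theorem lintegral_walkLaw {F : PathSpace → ENNReal} (hF : Measurable F) :
    ∫⁻ q, F q ∂(walkLaw P) =
      ∫⁻ g, ∫⁻ z, F (pathClass g.rep.G z) ∂(g.rep.G.srw (g.rep.mark ())) ∂P := by
  rw [walkLaw, Measure.lintegral_bind measurable_walkLawFrom.aemeasurable hF.aemeasurable]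
  refine lintegral_congr fun g => ?_
  conv_lhs => rw [← rootClass_rep g]
  exact lintegral_walkLawFrom hF _ _

theorem lintegral_walkLaw_first_step {F : PathSpace → ENNReal} (hF : Measurable F) :
    ∫⁻ q, F q ∂(walkLaw P) = ∫⁻ g, ∑' y, g.rep.G.step (g.rep.mark ()) y *
      ∫⁻ z, F (pathClass g.rep.G (consSeq (g.rep.mark ()) z)) ∂(g.rep.G.srw y) ∂P := by
  rw [lintegral_walkLaw P hF]
  refine lintegral_congr fun g => ?_
  exact g.rep.G.lintegral_srw_first_step _ (hF.comp (measurable_pathClass _))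

instance [IsProbabilityMeasure P] : IsProbabilityMeasure (walkLaw P) :=
  ⟨by
    have := lintegral_walkLaw P (measurable_const (a := (1 : ENNReal)))
    simpa using this⟩

instance [IsProbabilityMeasure P] : IsProbabilityMeasure (forwardLaw P) :=
  Measure.isProbabilityMeasure_map (measurable_biRootAt 0 1).aemeasurable

instance [IsProbabilityMeasure P] : IsProbabilityMeasure (backwardLaw P) :=
  Measure.isProbabilityMeasure_map (measurable_biRootAt 1 0).aemeasurable

variable {P}

theorem ae_srw_of_ae_walkLaw {p : PathSpace → Prop} (h : ∀ᵐ q ∂(walkLaw P), p q) :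
    ∀ᵐ g ∂P, ∀ᵐ z ∂(g.rep.G.srw (g.rep.mark ())), p (pathClass g.rep.G z) := by
  filter_upwards [Measure.ae_ae_of_ae_bind measurable_walkLawFrom.aemeasurable h] with g hg
  exact ae_of_ae_map (measurable_pathClass _).aemeasurable hg

theorem ae_walkLaw_of_ae_srw {p : PathSpace → Prop} (hp : MeasurableSet {q | p q})
    (h : ∀ᵐ g ∂P, ∀ᵐ z ∂(g.rep.G.srw (g.rep.mark ())), p (pathClass g.rep.G z)) :
    ∀ᵐ q ∂(walkLaw P), p q := by
  change walkLaw P {q | p q}ᶜ = 0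
  rw [← lintegral_indicator_one hp.compl, lintegral_walkLaw P (measurable_one.indicator hp.compl)]
  refine (lintegral_congr_ae (g := fun _ => 0) ?_).trans lintegral_zero
  filter_upwards [h] with g hg
  refine (lintegral_congr_ae (g := fun _ => 0) ?_).trans lintegral_zero
  filter_upwards [hg] with z hz
  rw [Set.indicator_of_notMem]
  exact fun h' => h' hz

/-- Averages over the first two positions of the walk. -/
theorem lintegral_walkLaw_pair {H : BiRooted → ENNReal} (hH : Measurable H) (m n : ℕ)
    (hm : m ≤ 1) (hn : n ≤ 1) :
    ∫⁻ q, H (biRootAt m n q) ∂(walkLaw P) = ∫⁻ g, ∑' y, g.rep.G.step (g.rep.mark ()) y *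
      H (pairClass g.rep.G (![g.rep.mark (), y] ⟨m, by omega⟩) (![g.rep.mark (), y] ⟨n, by omega⟩))
      ∂P := by
  rw [lintegral_walkLaw_first_step P (F := fun q => H (biRootAt m n q))
    (hH.comp (measurable_biRootAt m n))]
  refine lintegral_congr fun g => tsum_congr fun y => ?_
  congr 1
  have : ∀ᵐ z ∂(g.rep.G.srw y),
      H (biRootAt m n (pathClass g.rep.G (consSeq (g.rep.mark ()) z))) =
      H (pairClass g.rep.G (![g.rep.mark (), y] ⟨m, by omega⟩)
        (![g.rep.mark (), y] ⟨n, by omega⟩)) := by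
    filter_upwards [g.rep.G.srw_ae_zero y] with z hz
    rw [biRootAt_pathClass]
    congr 2
    · interval_cases m
      · rfl
      · exact hz
    · interval_cases n
      · rfl
      · exact hz
  exact (lintegral_congr_ae this).trans (by simp)

theorem lintegral_forwardLaw {H : BiRooted → ENNReal} (hH : Measurable H) :
    ∫⁻ b, H b ∂(forwardLaw P) = ∫⁻ g, ∑' y, g.rep.G.step (g.rep.mark ()) y *
      H (pairClass g.rep.G (g.rep.mark ()) y) ∂P := by
  rw [forwardLaw, lintegral_map hH (measurable_biRootAt 0 1),
    lintegral_walkLaw_pair hH 0 1 (by omega) le_rfl]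
  rfl

theorem lintegral_backwardLaw {H : BiRooted → ENNReal} (hH : Measurable H) :
    ∫⁻ b, H b ∂(backwardLaw P) = ∫⁻ g, ∑' y, g.rep.G.step (g.rep.mark ()) y *
      H (pairClass g.rep.G y (g.rep.mark ())) ∂P := by
  rw [backwardLaw, lintegral_map hH (measurable_biRootAt 1 0),
    lintegral_walkLaw_pair hH 1 0 le_rfl (by omega)]
  rfl

theorem measurable_lintegral_pairWalkLaw {F : PathSpace → ENNReal} (hF : Measurable F) :
    Measurable fun b => ∫⁻ q, F q ∂(pairWalkLaw b) :=
  (Measure.measurable_lintegral hF).comp measurable_pairWalkLaw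

/-- The walk is a step followed by an independent walk from its endpoint. -/
theorem lintegral_walkLaw_eq_forward {F : PathSpace → ENNReal} (hF : Measurable F) :
    ∫⁻ q, F q ∂(walkLaw P) = ∫⁻ b, ∫⁻ q, F q ∂(pairWalkLaw b) ∂(forwardLaw P) := by
  rw [lintegral_forwardLaw (measurable_lintegral_pairWalkLaw hF),
    lintegral_walkLaw_first_step P hF]
  simp only [lintegral_pairWalkLaw hF]

/-- Adding a step of the walk in front of the walk amounts to starting from a backward edge. -/
theorem lintegral_prependAvg_eq_backward {F : PathSpace → ENNReal} (hF : Measurable F) :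
    ∫⁻ q, prependAvg F q ∂(walkLaw P) =
      ∫⁻ b, ∫⁻ q, F q ∂(pairWalkLaw b) ∂(backwardLaw P) := by
  rw [lintegral_backwardLaw (measurable_lintegral_pairWalkLaw hF),
    lintegral_walkLaw P (measurable_prependAvg hF)]
  refine lintegral_congr fun g => ?_
  simp only [lintegral_pairWalkLaw hF]
  have hm : ∀ y, Measurable fun z => F (pathClass g.rep.G (consSeq y z)) := fun y =>
    (hF.comp (measurable_pathClass _)).comp (measurable_consSeq y)
  have h : ∫⁻ z, prependAvg F (pathClass g.rep.G z) ∂(g.rep.G.srw (g.rep.mark ())) =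
      ∫⁻ z, ∑' y, g.rep.G.step (g.rep.mark ()) y * F (pathClass g.rep.G (consSeq y z))
        ∂(g.rep.G.srw (g.rep.mark ())) := by
    refine lintegral_congr_ae ?_
    filter_upwards [g.rep.G.srw_ae_zero (g.rep.mark ())] with z hz
    rw [prependAvg_pathClass hF, hz]
  rw [h, lintegral_tsum fun y => ((hm y).const_mul _).aemeasurable]
  exact tsum_congr fun y => lintegral_const_mul _ (hm y)

/-- Stationarity of the root makes the law of the whole walk shift invariant. -/
theorem measurePreserving_shift (hstat : IsStationaryGraph P) :
    MeasurePreserving shift (walkLaw P) (walkLaw P) := by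
  refine ⟨measurable_shift, Measure.ext_of_lintegral _ fun F hF => ?_⟩
  have hφ : Measurable fun g => ∫⁻ q, F q ∂(walkLawFrom g) :=
    (Measure.measurable_lintegral hF).comp measurable_walkLawFrom
  have hP : ∫⁻ q, F q ∂(walkLaw P) = ∫⁻ g, ∫⁻ q, F q ∂(walkLawFrom g) ∂P := by
    rw [walkLaw, Measure.lintegral_bind measurable_walkLawFrom.aemeasurable hF.aemeasurable]
  rw [lintegral_map hF measurable_shift, hP]
  conv_rhs => rw [← hstat 1 le_rfl]
  rw [lintegral_map hφ (measurable_rootAt 1),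
    lintegral_walkLaw_first_step P (F := fun q => F (shift q)) (hF.comp measurable_shift),
    lintegral_walkLaw_first_step P (F := fun q => ∫⁻ p, F p ∂(walkLawFrom (rootAt 1 q)))
      (hφ.comp (measurable_rootAt 1))]
  refine lintegral_congr fun g => tsum_congr fun y => ?_
  congr 1
  have h1 : ∀ᵐ z ∂(g.rep.G.srw y),
      ∫⁻ q, F q ∂(walkLawFrom (rootAt 1 (pathClass g.rep.G (consSeq (g.rep.mark ()) z)))) =
        ∫⁻ z, F (pathClass g.rep.G z) ∂(g.rep.G.srw y) := by
    filter_upwards [g.rep.G.srw_ae_zero y] with z hz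
    rw [rootAt_pathClass, consSeq_succ, hz, lintegral_walkLawFrom hF]
  refine Eq.trans ?_ (lintegral_congr_ae h1).symm
  simp only [lintegral_const, measure_univ, mul_one, shift_pathClass, consSeq_succ]

theorem biRootAt_shift_iterate (m n k : ℕ) (q : PathSpace) :
    biRootAt m n (shift^[k] q) = biRootAt (m + k) (n + k) q := by
  induction k generalizing q with
  | zero => rfl
  | succ k ih =>
    rw [Function.iterate_succ_apply, ih, ← pathClass_rep q, shift_pathClass, biRootAt_pathClass,
      biRootAt_pathClass]
    rfl

/-- Every step of the stationary walk has the law of the first one. -/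
theorem map_biRootAt (hstat : IsStationaryGraph P) (n : ℕ) :
    (walkLaw P).map (biRootAt n (n + 1)) = forwardLaw P := by
  have h : biRootAt n (n + 1) = biRootAt 0 1 ∘ shift^[n] := by
    funext q
    rw [Function.comp, biRootAt_shift_iterate, zero_add, add_comm 1]
  rw [h, ← Measure.map_map (measurable_biRootAt 0 1) (measurable_shift.iterate n),
    ((measurePreserving_shift hstat).iterate n).map_eq, forwardLaw]

theorem measurable_flip : Measurable (MarkedClass.reindex ![1, 0] : BiRooted → BiRooted) :=
  (continuous_reindex indexedAt_biRooted indexedAt_biRooted _).measurable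

theorem reindex_flip_biRootAt (m n : ℕ) (q : PathSpace) :
    (biRootAt m n q).reindex ![1, 0] = biRootAt n m q := by
  rw [biRootAt, reindex_cls, biRootAt]
  congr 2
  funext i
  fin_cases i <;> rfl

theorem map_flip_forwardLaw :
    (forwardLaw P).map (MarkedClass.reindex ![1, 0]) = backwardLaw P := by
  rw [forwardLaw, Measure.map_map measurable_flip (measurable_biRootAt 0 1), backwardLaw]
  congr 1
  funext q
  exact reindex_flip_biRootAt 0 1 q

theorem map_flip_backwardLaw :
    (backwardLaw P).map (MarkedClass.reindex ![1, 0]) = forwardLaw P := by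
  rw [backwardLaw, Measure.map_map measurable_flip (measurable_biRootAt 1 0), forwardLaw]
  congr 1
  funext q
  exact reindex_flip_biRootAt 1 0 q

theorem LFGraph.inv_le_step_rev {G : LFGraph} {u v : G.V} {K : ENNReal}
    (hK : ((max 1 (G.deg v) : ℕ) : ENNReal) ≤ K) (h : G.step u v ≠ 0) : K⁻¹ ≤ G.step v u := by
  classical
  have h' : G.step v u ≠ 0 := by
    obtain ⟨c, h1, h2⟩ := G.step_eq_conductance u v
    rw [h1] at h
    rw [h2]
    exact mul_ne_zero (left_ne_zero_of_mul h) (ENNReal.inv_ne_zero.2 (ENNReal.natCast_ne_top _))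
  rw [LFGraph.step_apply, if_pos (LFGraph.step_ne_zero_iff G |>.1 h')]
  exact ENNReal.inv_le_inv.2 hK

/-- A stationary walk returns along its last edge with conditional probability at least `K⁻¹`, so
the backward law is at most `K` times the forward law. -/
theorem backwardLaw_le_smul (hstat : IsStationaryGraph P) {K : ENNReal} (hK0 : K ≠ 0)
    (hKtop : K ≠ ⊤)
    (hdeg : ∀ᵐ g ∂P, ∀ v : g.rep.G.V, ((max 1 (g.rep.G.deg v) : ℕ) : ENNReal) ≤ K) :
    backwardLaw P ≤ K • forwardLaw P := by
  refine Measure.le_iff.2 fun A hA => ?_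
  have hH : Measurable (A.indicator (1 : BiRooted → ENNReal)) := measurable_one.indicator hA
  rw [Measure.smul_apply, smul_eq_mul, ← lintegral_indicator_one hA, ← lintegral_indicator_one hA]
  suffices h : K⁻¹ * ∫⁻ b, A.indicator 1 b ∂(backwardLaw P) ≤
      ∫⁻ b, A.indicator 1 b ∂(forwardLaw P) by
    have := mul_le_mul_right h K
    rwa [← mul_assoc, ENNReal.mul_inv_cancel hK0 hKtop, one_mul] at this
  have hfw : ∫⁻ b, A.indicator 1 b ∂(forwardLaw P) = ∫⁻ g, ∑' y, g.rep.G.step (g.rep.mark ()) y *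
      ∑' v, g.rep.G.step y v * A.indicator 1 (pairClass g.rep.G y v) ∂P := by
    rw [← map_biRootAt hstat 1, lintegral_map hH (measurable_biRootAt 1 2),
      lintegral_walkLaw_first_step P (F := fun q => A.indicator 1 (biRootAt 1 2 q))
        (hH.comp (measurable_biRootAt 1 2))]
    refine lintegral_congr fun g => tsum_congr fun y => ?_
    congr 1
    have hm : Measurable fun z => A.indicator (1 : BiRooted → ENNReal)
        (biRootAt 1 2 (pathClass g.rep.G (consSeq (g.rep.mark ()) z))) :=
      (hH.comp (measurable_biRootAt 1 2)).comp
        ((measurable_pathClass _).comp (measurable_consSeq _))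
    rw [g.rep.G.lintegral_srw_first_step y hm]
    refine tsum_congr fun v => ?_
    congr 1
    have : ∀ᵐ z ∂(g.rep.G.srw v), A.indicator (1 : BiRooted → ENNReal)
        (biRootAt 1 2 (pathClass g.rep.G (consSeq (g.rep.mark ()) (consSeq y z)))) =
        A.indicator 1 (pairClass g.rep.G y v) := by
      filter_upwards [g.rep.G.srw_ae_zero v] with z hz
      rw [biRootAt_pathClass]
      simp only [consSeq_succ, consSeq_zero, hz]
    exact (lintegral_congr_ae this).trans (by simp)
  rw [hfw, lintegral_backwardLaw hH, ← lintegral_const_mul' _ _ (ENNReal.inv_ne_top.2 hK0)]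
  refine lintegral_mono_ae ?_
  filter_upwards [hdeg] with g hg
  rw [← ENNReal.tsum_mul_left]
  refine ENNReal.tsum_le_tsum fun y => ?_
  rw [mul_left_comm]
  by_cases hy : g.rep.G.step (g.rep.mark ()) y = 0
  · rw [hy, zero_mul, zero_mul]
  · gcongr
    refine le_trans ?_ (ENNReal.le_tsum (g.rep.mark ()))
    gcongr
    exact LFGraph.inv_le_step_rev (hg y) hy

theorem forwardLaw_le_smul {K : ENNReal} (h : backwardLaw P ≤ K • forwardLaw P) :
    forwardLaw P ≤ K • backwardLaw P := by
  rw [← map_flip_backwardLaw, ← map_flip_forwardLaw, ← Measure.map_smul]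
  rw [map_flip_forwardLaw]
  exact Measure.map_mono h measurable_flip

end WalkLaw

section Cocycle

variable {P : Measure Rooted}

/-- The Radon–Nikodym cocycle as an extended nonnegative function. -/
noncomputable def density (P : Measure Rooted) : BiRooted → ENNReal :=
  (backwardLaw P).rnDeriv (forwardLaw P)

theorem measurable_density : Measurable (density P) := Measure.measurable_rnDeriv _ _

/-- The product of the cocycle along the first `n` steps. -/
noncomputable def densityProd (P : Measure Rooted) (n : ℕ) (q : PathSpace) : ENNReal :=
  ∏ i ∈ Finset.range n, density P (biRootAt i (i + 1) q)

theorem measurable_densityProd (n : ℕ) : Measurable (densityProd P n) :=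
  Finset.measurable_prod _ fun i _ => measurable_density.comp (measurable_biRootAt i (i + 1))

theorem densityProd_pathClass (n : ℕ) (G : LFGraph) (x : ℕ → G.V) :
    densityProd P n (pathClass G x) =
      ∏ i ∈ Finset.range n, density P (pairClass G (x i) (x (i + 1))) := by
  simp only [densityProd, biRootAt_pathClass]

variable [IsProbabilityMeasure P]

/-- Extending the walk by one step into the past changes its law by the factor
`Δ(G, X₀, X₁)`. -/
theorem lintegral_prependAvg (hac : backwardLaw P ≪ forwardLaw P) {F : PathSpace → ENNReal}
    (hF : Measurable F) :
    ∫⁻ q, prependAvg F q ∂(walkLaw P) = ∫⁻ q, density P (biRootAt 0 1 q) * F q ∂(walkLaw P) := by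
  have hF' : Measurable fun q => density P (biRootAt 0 1 q) * F q :=
    (measurable_density.comp (measurable_biRootAt 0 1)).mul hF
  rw [lintegral_prependAvg_eq_backward hF, lintegral_walkLaw_eq_forward hF',
    ← lintegral_rnDeriv_mul hac (measurable_lintegral_pairWalkLaw hF).aemeasurable]
  refine lintegral_congr fun b => ?_
  rw [← pairClass_rep b, lintegral_pairWalkLaw hF, lintegral_pairWalkLaw hF',
    ← lintegral_const_mul (f := fun z => F (pathClass _ (consSeq _ z))) _
      ((hF.comp (measurable_pathClass _)).comp (measurable_consSeq _))]
  refine lintegral_congr_ae ?_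
  filter_upwards [b.rep.G.srw_ae_zero (b.rep.mark 1)] with z hz
  rw [biRootAt_pathClass, consSeq_succ, hz]
  rfl

/-- Time reversal: the law of the reversed path has the product of the cocycle along the path as
density with respect to the law of the path. -/
theorem lintegral_reverse (hac : backwardLaw P ≪ forwardLaw P) (n : ℕ) {F : PathSpace → ENNReal}
    (hF : Measurable F) :
    ∫⁻ q, F (q.reindex fun i => n - i) ∂(walkLaw P) =
      ∫⁻ q, F (q.reindex fun i => min i n) * densityProd P n q ∂(walkLaw P) := by
  -- averaging over the last step of the reversed path is `prependAvg`
  have hrev : ∀ n {F : PathSpace → ENNReal}, Measurable F →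
      ∫⁻ q, F (q.reindex fun i => n - i) ∂(walkLaw P) =
        ∫⁻ g, prependAvg^[n] F (pathClass g.rep.G fun _ => g.rep.mark ()) ∂P := by
    intro n F hF
    rw [lintegral_walkLaw P (F := fun q => F (q.reindex fun i => n - i))
      (hF.comp (measurable_reindex_path _))]
    refine lintegral_congr fun g => ?_
    rw [prependAvg_iterate_pathClass hF]
    refine lintegral_congr_ae ?_
    filter_upwards [g.rep.G.srw_ae_zero (g.rep.mark ())] with z hz
    rw [reindex_pathClass]
    congr 2
    funext i
    unfold revPrefix
    split_ifs with h
    · rfl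
    · rw [Nat.sub_eq_zero_of_le (by omega), hz]
  induction n generalizing F with
  | zero =>
    simp [densityProd]
  | succ n ih =>
    rw [hrev (n + 1) hF, Function.iterate_succ_apply, ← hrev n (measurable_prependAvg hF),
      ih (measurable_prependAvg hF)]
    have hH : Measurable fun q : PathSpace =>
        F (q.reindex fun i => min i (n + 1)) * densityProd P n (shift q) :=
      (hF.comp (measurable_reindex_path _)).mul ((measurable_densityProd n).comp measurable_shift)
    have h1 : ∀ q : PathSpace, prependAvg F (q.reindex fun i => min i n) * densityProd P n q =
        prependAvg
          (fun q => F (q.reindex fun i => min i (n + 1)) * densityProd P n (shift q)) q := by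
      intro q
      rw [← pathClass_rep q, reindex_pathClass, prependAvg_pathClass hF, prependAvg_pathClass hH,
        ← ENNReal.tsum_mul_right]
      refine tsum_congr fun y => ?_
      rw [mul_assoc, shift_pathClass, reindex_pathClass, Nat.zero_min]
      simp only [consSeq_succ]
      congr 3
      congr 1
      funext i
      cases i with
      | zero => rfl
      | succ i => rw [Nat.succ_min_succ]; rfl
    simp only [h1]
    rw [lintegral_prependAvg hac hH]
    refine lintegral_congr fun q => ?_
    have h2 : densityProd P (n + 1) q = density P (biRootAt 0 1 q) * densityProd P n (shift q) := by
      rw [← pathClass_rep q, shift_pathClass, densityProd_pathClass, densityProd_pathClass,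
        Finset.prod_range_succ', mul_comm, biRootAt_pathClass]
    rw [h2]
    ring

/-- The cocycle property: the product of the cocycle along a closed path is one. -/
theorem ae_densityProd_eq_one (hac : backwardLaw P ≪ forwardLaw P) (n : ℕ) :
    ∀ᵐ q ∂(walkLaw P), distAt n q = 0 → densityProd P n q = 1 := by
  set E : Set PathSpace := {q | distAt n q = 0} with hE
  have hEm : MeasurableSet E := measurable_distAt n (measurableSet_singleton 0)
  have htrunc : Measurable fun q : PathSpace => q.reindex fun i => min i n :=
    measurable_reindex_path _
  have hEpath : ∀ (G : LFGraph) (x : ℕ → G.V), pathClass G x ∈ E ↔ x n = x 0 := fun G x => by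
    change distAt n _ = 0 ↔ _
    rw [distAt_pathClass, G.connected.dist_eq_zero_iff, eq_comm]
  have hZ : ∀ q : PathSpace, densityProd P n (q.reindex fun i => min i n) = densityProd P n q := by
    intro q
    rw [← pathClass_rep q, reindex_pathClass, densityProd_pathClass, densityProd_pathClass]
    refine Finset.prod_congr rfl fun i hi => ?_
    have := Finset.mem_range.1 hi
    rw [min_eq_left this.le, min_eq_left (by omega)]
  -- `ν` is the law of the first `n` steps on the event that they close up; reversing them
  -- preserves it, and by `lintegral_reverse` multiplies it by the product of the cocycle
  set ν := ((walkLaw P).restrict E).map fun q : PathSpace => q.reindex fun i => min i n with hν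
  have key : ν.withDensity (densityProd P n) = ν.withDensity 1 := by
    refine Measure.ext fun A hA => ?_
    have hF : Measurable ((A ∩ E).indicator (1 : PathSpace → ENNReal)) :=
      measurable_one.indicator (hA.inter hEm)
    have hind : ∀ p, (A ∩ E).indicator (1 : PathSpace → ENNReal) p =
        E.indicator (A.indicator 1) p := fun p => by
      rw [Set.indicator_indicator, Set.inter_comm]
    have h1 := lintegral_reverse hac n hF
    have h2 : ∫⁻ q, (A ∩ E).indicator (1 : PathSpace → ENNReal) (q.reindex fun i => n - i)
        ∂(walkLaw P) =
        ∫⁻ q, (A ∩ E).indicator (1 : PathSpace → ENNReal) (q.reindex fun i => min i n)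
        ∂(walkLaw P) := by
      rw [lintegral_walkLaw P (F := fun q => (A ∩ E).indicator 1 (q.reindex fun i => n - i))
          (hF.comp (measurable_reindex_path _)),
        lintegral_walkLaw P (F := fun q => (A ∩ E).indicator 1 (q.reindex fun i => min i n))
          (hF.comp (measurable_reindex_path _))]
      refine lintegral_congr fun g => ?_
      have h3 := g.rep.G.lintegral_loop_rev (g.rep.mark ()) n
        fun x => A.indicator 1 (pathClass g.rep.G x)
      refine Eq.trans ?_ (h3.trans ?_)
      · refine lintegral_congr fun z => ?_
        have : pathClass g.rep.G (fun i => z (n - i)) ∈ E ↔ z n = z 0 := by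
          rw [hEpath, Nat.sub_self, Nat.sub_zero, eq_comm]
        rw [reindex_pathClass, hind]
        by_cases hz : z n = z 0 <;> simp [this, hz]
      · refine lintegral_congr fun z => ?_
        have : pathClass g.rep.G (fun i => z (min i n)) ∈ E ↔ z n = z 0 := by
          rw [hEpath, Nat.min_self, Nat.zero_min]
        rw [reindex_pathClass, hind]
        by_cases hz : z n = z 0 <;> simp [this, hz]
    have hEtr : ∀ q : PathSpace, (q.reindex fun i => min i n) ∈ E ↔ q ∈ E := fun q => by
      rw [← pathClass_rep q, reindex_pathClass, hEpath, hEpath, Nat.min_self, Nat.zero_min]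
    have h4 : ∀ h : PathSpace → ENNReal, Measurable h → ν.withDensity h A =
        ∫⁻ q, (A ∩ E).indicator (1 : PathSpace → ENNReal) (q.reindex fun i => min i n) *
          h (q.reindex fun i => min i n) ∂(walkLaw P) := by
      intro h hh
      rw [withDensity_apply _ hA, ← lintegral_indicator hA, hν,
        lintegral_map (hh.indicator hA) htrunc, ← lintegral_indicator hEm]
      refine lintegral_congr fun q => ?_
      have := hEtr q
      by_cases hq : q ∈ E <;>
        by_cases hq' : (q.reindex fun i => min i n) ∈ A <;>
        simp [hq, hq', this]
    rw [h4 _ (measurable_densityProd n), h4 _ measurable_one]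
    simp only [hZ, Pi.one_apply, mul_one]
    rw [← h1, h2]
  have h5 : densityProd P n =ᵐ[ν] 1 :=
    (withDensity_eq_iff_of_sigmaFinite (measurable_densityProd n).aemeasurable
      measurable_one.aemeasurable).1 key
  have h6 := (ae_restrict_iff' hEm).1 (ae_of_ae_map htrunc.aemeasurable h5)
  filter_upwards [h6] with q hq hd
  have := hq hd
  rwa [hZ] at this

end Cocycle
/-! ### Drift of the cocycle and the speed of the walk -/

/-- If a function on pairs of vertices sums to zero along almost every closed walk and is bounded
by `c` along the walk, then its sum along the walk is at most `c` times the distance travelled: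
every finite path followed by a geodesic back to its origin is a closed path, and simple random
walk follows it with positive probability. -/
theorem LFGraph.ae_abs_sum_le_of_closed {G : LFGraph} {x : G.V} {l : G.V → G.V → ℝ} {c : ℝ}
    (h : ∀ᵐ z ∂(G.srw x), (∀ i, |l (z i) (z (i + 1))| ≤ c) ∧
      ∀ n, z n = z 0 → ∑ i ∈ Finset.range n, l (z i) (z (i + 1)) = 0) :
    ∀ᵐ z ∂(G.srw x), ∀ n,
      |∑ i ∈ Finset.range n, l (z i) (z (i + 1))| ≤ c * G.graph.dist (z 0) (z n) := by
  filter_upwards [G.srw_ae_zero x, G.srw_ae_step_ne_zero x] with z hz0 hz n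
  obtain ⟨p, hp⟩ := G.connected.exists_walk_length_eq_dist (z n) (z 0)
  rw [SimpleGraph.dist_comm, ← hp]
  set a : ℕ → G.V := fun i => if i ≤ n then z i else p.getVert (i - n) with ha
  have ha1 : ∀ i ≤ n, a i = z i := fun i hi => if_pos hi
  have ha2 : ∀ j, a (n + j) = p.getVert j := fun j => by
    rcases Nat.eq_zero_or_pos j with rfl | hj
    · rw [add_zero, ha1 n le_rfl, SimpleGraph.Walk.getVert_zero]
    · rw [ha]
      simp only
      rw [if_neg (by omega), Nat.add_sub_cancel_left]
  have hstep : ∀ i < n + p.length, G.step (a i) (a (i + 1)) ≠ 0 := by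
    intro i hi
    rcases Nat.lt_or_ge i n with h1 | h1
    · rw [ha1 i h1.le, ha1 (i + 1) h1]
      exact hz i
    · obtain ⟨j, rfl⟩ := Nat.exists_eq_add_of_le h1
      rw [ha2, add_assoc, ha2]
      exact G.step_ne_zero_iff.2 (Or.inl (p.adj_getVert_succ (by omega)))
  have hpos := G.srw_initSeg_ne_zero (n := n + p.length) (a := initSeg _ a)
    fun i => hstep i i.2
  have hax : initSeg (n + p.length) a 0 = x := (ha1 0 (Nat.zero_le _)).trans hz0
  rw [hax] at hpos
  obtain ⟨y, hy, hyb, hyc⟩ := ((frequently_ae_iff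
    (p := fun y => initSeg (n + p.length) y = initSeg _ a)).2 hpos |>.and_eventually h).exists
  have hya : ∀ i ≤ n + p.length, y i = a i := fun i hi =>
    congrFun hy ⟨i, Nat.lt_succ_of_le hi⟩
  have hclosed := hyc (n + p.length) (by
    rw [hya _ le_rfl, hya 0 (Nat.zero_le _), ha2, ha1 0 (Nat.zero_le _),
      SimpleGraph.Walk.getVert_length])
  rw [Finset.sum_range_add] at hclosed
  have h1 : ∑ i ∈ Finset.range n, l (y i) (y (i + 1)) =
      ∑ i ∈ Finset.range n, l (z i) (z (i + 1)) := by
    refine Finset.sum_congr rfl fun i hi => ?_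
    have hi' := Finset.mem_range.1 hi
    rw [hya i (by omega), hya (i + 1) (by omega), ha1 i (by omega), ha1 (i + 1) (by omega)]
  rw [← h1, eq_neg_of_add_eq_zero_left hclosed, abs_neg]
  refine (Finset.abs_sum_le_sum_abs _ _).trans
    ((Finset.sum_le_sum fun i _ => hyb (n + i)).trans ?_)
  simp [mul_comm]

variable {P : Measure Rooted}

theorem distAt_add_le (m n : ℕ) (q : PathSpace) :
    distAt (m + n) q ≤ distAt m q + distAt n (shift^[m] q) := by
  have h : ∀ m (G : LFGraph) (x : ℕ → G.V),
      shift^[m] (pathClass G x) = pathClass G fun i => x (i + m) := by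
    intro m G
    induction m with
    | zero => intro x; rfl
    | succ m ih =>
      intro x
      rw [Function.iterate_succ_apply, shift_pathClass, ih]
      congr 1
  rw [← pathClass_rep q, h, distAt_pathClass, distAt_pathClass, distAt_pathClass, zero_add,
    add_comm n m]
  exact LFGraph.connected _ |>.dist_triangle

theorem ae_distAt_le : ∀ᵐ q ∂(walkLaw P), ∀ n, distAt n q ≤ n := by
  have hm : MeasurableSet {q | ∀ n, distAt n q ≤ n} := by
    have : {q | ∀ n, distAt n q ≤ n} = ⋂ n, {q | distAt n q ≤ n} := by ext q; simp
    rw [this]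
    exact MeasurableSet.iInter fun n => measurableSet_le (measurable_distAt n) measurable_const
  refine ae_walkLaw_of_ae_srw hm (Eventually.of_forall fun g => ?_)
  filter_upwards [g.rep.G.srw_ae_step_ne_zero (g.rep.mark ())] with z hz n
  rw [distAt_pathClass]
  exact g.rep.G.dist_le_of_steps hz n

theorem ae_degree_le {M : ℝ} (hdeg : DegreesBoundedBy P M) :
    ∀ᵐ g ∂P, ∀ v : g.rep.G.V,
      ((max 1 (g.rep.G.deg v) : ℕ) : ENNReal) ≤ ENNReal.ofReal (max M 1) := by
  filter_upwards [hdeg] with g hg v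
  rw [← ENNReal.ofReal_natCast]
  refine ENNReal.ofReal_le_ofReal ?_
  push_cast
  exact max_le (le_max_right _ _) ((hg v).trans (le_max_left _ _))

theorem cocycle_eq (b : BiRooted) : cocycle P b = (density P b).toReal := rfl

theorem measurable_log_cocycle : Measurable fun b => Real.log (cocycle P b) :=
  Real.measurable_log.comp measurable_density.ennreal_toReal

theorem ae_forall_biRootAt (hstat : IsStationaryGraph P) {p : BiRooted → Prop}
    (h : ∀ᵐ b ∂(forwardLaw P), p b) : ∀ᵐ q ∂(walkLaw P), ∀ i, p (biRootAt i (i + 1) q) := by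
  refine ae_all_iff.2 fun i => ?_
  rw [← map_biRootAt hstat i] at h
  exact ae_of_ae_map (measurable_biRootAt i (i + 1)).aemeasurable h

theorem integral_logCocycle : ∫ q, logCocycle P q ∂(walkLaw P) =
    ∫ b, Real.log (cocycle P b) ∂(forwardLaw P) := by
  rw [forwardLaw, integral_map (measurable_biRootAt 0 1).aemeasurable
    measurable_log_cocycle.aestronglyMeasurable]
  rfl

variable [IsProbabilityMeasure P]

/-- Comparing the two laws in both directions bounds the cocycle from above and from below. -/
theorem ae_density_mem {K : ENNReal} (hK0 : K ≠ 0) (hKtop : K ≠ ⊤)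
    (hle : backwardLaw P ≤ K • forwardLaw P) :
    ∀ᵐ b ∂(forwardLaw P), K⁻¹ ≤ density P b ∧ density P b ≤ K := by
  have hac : backwardLaw P ≪ forwardLaw P := Measure.absolutelyContinuous_of_le_smul hle
  have h1 : (fun _ => K⁻¹) ≤ᵐ[forwardLaw P] density P := by
    refine ae_le_of_forall_setLIntegral_le_of_sigmaFinite measurable_const fun s hs _ => ?_
    rw [setLIntegral_const, density, Measure.setLIntegral_rnDeriv hac]
    have h := forwardLaw_le_smul hle s
    rw [Measure.smul_apply, smul_eq_mul] at h
    refine (mul_le_mul_right h _).trans (le_of_eq ?_)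
    rw [← mul_assoc, ENNReal.inv_mul_cancel hK0 hKtop, one_mul]
  have h2 : density P ≤ᵐ[forwardLaw P] fun _ => K := by
    refine ae_le_of_forall_setLIntegral_le_of_sigmaFinite measurable_density fun s hs _ => ?_
    rw [setLIntegral_const, density, Measure.setLIntegral_rnDeriv hac]
    exact hle s
  filter_upwards [h1, h2] with b hb1 hb2
  exact ⟨hb1, hb2⟩

theorem ae_cocycle_mem {K : ℝ} (hK : 1 ≤ K)
    (hle : backwardLaw P ≤ ENNReal.ofReal K • forwardLaw P) :
    ∀ᵐ b ∂(forwardLaw P),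
      0 < cocycle P b ∧ cocycle P b ≤ K ∧ |Real.log (cocycle P b)| ≤ Real.log K := by
  have hK0 : 0 < K := by linarith
  filter_upwards [ae_density_mem (ENNReal.ofReal_pos.2 hK0).ne' ENNReal.ofReal_ne_top hle]
    with b ⟨h1, h2⟩
  have htop : density P b ≠ ⊤ := ne_top_of_le_ne_top ENNReal.ofReal_ne_top h2
  rw [cocycle_eq]
  have h3 : (density P b).toReal ≤ K := ENNReal.toReal_le_of_le_ofReal hK0.le h2
  have h4 : K⁻¹ ≤ (density P b).toReal := by
    rw [← ENNReal.ofReal_inv_of_pos hK0] at h1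
    exact (ENNReal.ofReal_le_iff_le_toReal htop).1 h1
  have h5 : 0 < (density P b).toReal := lt_of_lt_of_le (by positivity) h4
  refine ⟨h5, h3, abs_le.2 ⟨?_, Real.log_le_log h5 h3⟩⟩
  rw [← Real.log_inv]
  exact Real.log_le_log (by positivity) h4

/-- The logarithm of the cocycle along the walk is controlled by the distance travelled. -/
theorem ae_abs_sum_log_cocycle_le (hstat : IsStationaryGraph P) {K : ℝ} (hK : 1 ≤ K)
    (hle : backwardLaw P ≤ ENNReal.ofReal K • forwardLaw P) :
    ∀ᵐ q ∂(walkLaw P), ∀ n,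
      |∑ i ∈ Finset.range n, Real.log (cocycle P (biRootAt i (i + 1) q))| ≤
        Real.log K * distAt n q := by
  have hac : backwardLaw P ≪ forwardLaw P := Measure.absolutelyContinuous_of_le_smul hle
  have hmeas : ∀ i, Measurable fun q => Real.log (cocycle P (biRootAt i (i + 1) q)) :=
    fun i => measurable_log_cocycle.comp (measurable_biRootAt i (i + 1))
  have hclosed : ∀ᵐ q ∂(walkLaw P),
      (∀ i, |Real.log (cocycle P (biRootAt i (i + 1) q))| ≤ Real.log K) ∧
      ∀ n, distAt n q = 0 →
        ∑ i ∈ Finset.range n, Real.log (cocycle P (biRootAt i (i + 1) q)) = 0 := by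
    filter_upwards [ae_forall_biRootAt hstat (ae_cocycle_mem hK hle),
      ae_all_iff.2 fun n => ae_densityProd_eq_one hac n] with q hq hZ
    refine ⟨fun i => (hq i).2.2, fun n hn => ?_⟩
    rw [← Real.log_prod fun i _ => (hq i).1.ne']
    simp only [cocycle_eq]
    rw [← ENNReal.toReal_prod, show ∏ i ∈ Finset.range n, density P (biRootAt i (i + 1) q) = 1 from
      hZ n hn]
    simp
  have hmeasSet : MeasurableSet {q | ∀ n,
      |∑ i ∈ Finset.range n, Real.log (cocycle P (biRootAt i (i + 1) q))| ≤
        Real.log K * distAt n q} := by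
    have : {q | ∀ n, |∑ i ∈ Finset.range n, Real.log (cocycle P (biRootAt i (i + 1) q))| ≤
        Real.log K * distAt n q} = ⋂ n, {q |
        |∑ i ∈ Finset.range n, Real.log (cocycle P (biRootAt i (i + 1) q))| ≤
        Real.log K * distAt n q} := by ext q; simp
    rw [this]
    refine MeasurableSet.iInter fun n => measurableSet_le ?_ ?_
    · exact (Finset.measurable_sum _ fun i _ => hmeas i).abs
    · exact ((measurable_of_countable fun k : ℕ => (k : ℝ)).comp (measurable_distAt n)).const_mul _
  refine ae_walkLaw_of_ae_srw hmeasSet ?_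
  filter_upwards [ae_srw_of_ae_walkLaw hclosed] with g hg
  have key := LFGraph.ae_abs_sum_le_of_closed (G := g.rep.G) (x := g.rep.mark ())
    (l := fun u v => Real.log (cocycle P (pairClass g.rep.G u v))) (c := Real.log K) (by
      filter_upwards [hg] with z hz
      simp only [biRootAt_pathClass, distAt_pathClass] at hz
      exact ⟨hz.1, fun n hn => hz.2 n (by rw [hn, SimpleGraph.dist_self])⟩)
  filter_upwards [key] with z hz n
  simp only [biRootAt_pathClass, distAt_pathClass]
  exact hz n

/-- Strict Jensen: the mean of the logarithm of the cocycle is negative unless the graph is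
reversible. -/
theorem integral_log_cocycle_neg {K : ℝ} (hK : 1 ≤ K)
    (hle : backwardLaw P ≤ ENNReal.ofReal K • forwardLaw P) (hrev : ¬ IsReversibleGraph P) :
    ∫ b, Real.log (cocycle P b) ∂(forwardLaw P) < 0 := by
  have hac : backwardLaw P ≪ forwardLaw P := Measure.absolutelyContinuous_of_le_smul hle
  have hmem := ae_cocycle_mem hK hle
  have hint : Integrable (fun b => Real.log (cocycle P b)) (forwardLaw P) :=
    Integrable.of_bound measurable_log_cocycle.aestronglyMeasurable (Real.log K)
      (hmem.mono fun _ hb => hb.2.2)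
  have hint' : Integrable (cocycle P) (forwardLaw P) := Measure.integrable_toReal_rnDeriv
  have hone : ∫ b, cocycle P b ∂(forwardLaw P) = 1 := by
    have := Measure.integral_toReal_rnDeriv hac
    simpa [cocycle] using this
  by_contra! hcon
  have hnn : 0 ≤ᵐ[forwardLaw P] fun b => cocycle P b - 1 - Real.log (cocycle P b) := by
    filter_upwards [hmem] with b hb
    have := Real.log_le_sub_one_of_pos hb.1
    change (0 : ℝ) ≤ _
    linarith
  have hi : ∫ b, (cocycle P b - 1 - Real.log (cocycle P b)) ∂(forwardLaw P) ≤ 0 := by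
    rw [integral_sub (f := fun b => cocycle P b - 1) (hint'.sub (integrable_const _)) hint,
      integral_sub hint' (integrable_const _), hone]
    simpa using hcon
  have hzero := (integral_eq_zero_iff_of_nonneg_ae hnn
    ((hint'.sub (integrable_const 1)).sub hint)).1 (le_antisymm hi (integral_nonneg_of_ae hnn))
  refine hrev ?_
  have hd : density P =ᵐ[forwardLaw P] 1 := by
    filter_upwards [hmem, hzero] with b hb hb0
    have h1 : cocycle P b = 1 := by
      by_contra hne
      have := Real.log_lt_sub_one_of_pos hb.1 hne
      change cocycle P b - 1 - Real.log (cocycle P b) = 0 at hb0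
      linarith
    rw [cocycle_eq] at h1
    exact (ENNReal.toReal_eq_one_iff _).1 h1
  have h := Measure.withDensity_rnDeriv_eq _ _ hac
  rw [IsReversibleGraph, ← h]
  exact (withDensity_one (μ := forwardLaw P)).symm.trans (withDensity_congr_ae hd.symm)

end StationaryGraph

theorem theorem4p4 (P : Measure Rooted) [IsProbabilityMeasure P] (M : ℝ) (hM : 0 < M)
    (hstat : IsStationaryGraph P) (herg : IsErgodicGraph P) (hdeg : DegreesBoundedBy P M)
    (hrev : ¬ IsReversibleGraph P) :
    (backwardLaw P ≪ forwardLaw P ∧ forwardLaw P ≪ backwardLaw P ∧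
      Integrable (logCocycle P) (walkLaw P)) ∧
    ∃ s : ℝ,
      (∀ᵐ q ∂(walkLaw P), Tendsto (fun n : ℕ => (distAt n q : ℝ) / n) atTop (𝓝 s)) ∧
      Tendsto (fun n : ℕ => eLpNorm (fun q => (distAt n q : ℝ) / n - s) 1 (walkLaw P))
        atTop (𝓝 0) ∧
      0 < s ∧
      0 < |∫ q, logCocycle P q ∂(walkLaw P)| / Real.log M ∧
      |∫ q, logCocycle P q ∂(walkLaw P)| / Real.log M ≤ s := by
  set K : ℝ := max M 1 with hKdef
  have hK : 1 ≤ K := le_max_right _ _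
  have hle : backwardLaw P ≤ ENNReal.ofReal K • forwardLaw P :=
    backwardLaw_le_smul hstat (ENNReal.ofReal_pos.2 (by linarith)).ne' ENNReal.ofReal_ne_top
      (ae_degree_le hdeg)
  have hmem := ae_forall_biRootAt hstat (ae_cocycle_mem hK hle)
  have hmeas : ∀ i, Measurable fun q => Real.log (cocycle P (biRootAt i (i + 1) q)) :=
    fun i => measurable_log_cocycle.comp (measurable_biRootAt i (i + 1))
  have hint : ∀ i, Integrable (fun q => Real.log (cocycle P (biRootAt i (i + 1) q))) (walkLaw P) :=
    fun i => Integrable.of_bound (hmeas i).aestronglyMeasurable (Real.log K)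
      (hmem.mono fun _ hq => (hq i).2.2)
  have hneg : ∫ q, logCocycle P q ∂(walkLaw P) < 0 := by
    rw [integral_logCocycle]
    exact integral_log_cocycle_neg hK hle hrev
  have habs : 0 < |∫ q, logCocycle P q ∂(walkLaw P)| := abs_pos.2 hneg.ne
  -- a nonzero mean of `log Δ` forces a bound larger than one on `Δ`, hence on the degrees
  have hlogK : 0 < Real.log K := by
    refine habs.trans_le ?_
    have := norm_integral_le_of_norm_le_const (μ := walkLaw P) (f := logCocycle P)
      (C := Real.log K) (hmem.mono fun _ hq => (hq 0).2.2)
    simpa using this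
  have hKM : K = M := by
    rcases max_choice M 1 with h | h
    · exact h
    · rw [hKdef, h, Real.log_one] at hlogK
      exact absurd hlogK (lt_irrefl _)
  have hbd : ∀ᵐ q ∂(walkLaw P), ∀ n : ℕ, |(distAt n q : ℝ)| ≤ 1 * n := by
    filter_upwards [ae_distAt_le (P := P)] with q hq n
    rw [Nat.abs_cast, one_mul]
    exact_mod_cast hq n
  have hdm : ∀ n, Measurable fun q => (distAt n q : ℝ) := fun n =>
    (measurable_of_countable fun k : ℕ => (k : ℝ)).comp (measurable_distAt n)
  obtain ⟨s, hs1, hs2, hs3⟩ := exists_tendsto_div_of_subadditive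
    (a := fun n q => (distAt n q : ℝ)) (C := 1) (μ := walkLaw P)
    ⟨measurePreserving_shift hstat, herg⟩ hdm
    (fun m n q => by exact_mod_cast distAt_add_le m n q) hbd
  have hspeed : |∫ q, logCocycle P q ∂(walkLaw P)| / Real.log M ≤ s := by
    rw [← hKM]
    refine hs3 _ fun n => ?_
    rw [div_mul_eq_mul_div, div_le_iff₀ hlogK, mul_comm (∫ q, (distAt n q : ℝ) ∂(walkLaw P))]
    have h1 : ∫ q, ∑ i ∈ Finset.range n, Real.log (cocycle P (biRootAt i (i + 1) q)) ∂(walkLaw P) =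
        n * ∫ q, logCocycle P q ∂(walkLaw P) := by
      rw [integral_finsetSum _ fun i _ => hint i]
      have : ∀ i, ∫ q, Real.log (cocycle P (biRootAt i (i + 1) q)) ∂(walkLaw P) =
          ∫ q, logCocycle P q ∂(walkLaw P) := fun i => by
        rw [integral_logCocycle, ← map_biRootAt hstat i,
          integral_map (measurable_biRootAt i (i + 1)).aemeasurable
            measurable_log_cocycle.aestronglyMeasurable]
      simp [this]
    have h2 : |(n : ℝ) * ∫ q, logCocycle P q ∂(walkLaw P)| ≤
        ∫ q, Real.log K * (distAt n q : ℝ) ∂(walkLaw P) := by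
      rw [← h1]
      refine (abs_integral_le_integral_abs).trans (integral_mono_ae
        (integrable_finsetSum _ fun i _ => hint i).abs
        ((integrable_of_linear_bound hdm hbd n).const_mul _) ?_)
      filter_upwards [ae_abs_sum_log_cocycle_le hstat hK hle] with q hq
      exact hq n
    rwa [abs_mul, Nat.abs_cast, mul_comm, integral_const_mul] at h2
  have hpos : 0 < |∫ q, logCocycle P q ∂(walkLaw P)| / Real.log M :=
    div_pos habs (hKM ▸ hlogK)
  exact ⟨⟨Measure.absolutelyContinuous_of_le_smul hle,
    Measure.absolutelyContinuous_of_le_smul (forwardLaw_le_smul hle), hint 0⟩,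
    s, hs1, hs2, hpos.trans_le hspeed, hpos, hspeed⟩
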